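/- Let $B$ be the Hamilton quaternion algebra with basis $1,i,j,k$, conjugation $\mathbf{x}\mapsto\overline{\mathbf{x}}$, reduced trace $\mathrm{tr}(\mathbf{x})=\mathbf{x}+\overline{\mathbf{x}}$ and reduced norm $\mathrm{nr}(\mathbf{x})=\mathbf{x}\overline{\mathbf{x}}$; let $B(\mathbb{Z})=\mathbb{Z}+\mathbb{Z}i+\mathbb{Z}j+\mathbb{Z}k$, and identify the sphere $S^3$ with the real quaternions of reduced norm $1$. Let $U_n$ be the $n$-th Chebyshev polynomial of the second kind, $U_n(\cos\theta)=\sin((n+1)\theta)/\sin\theta$. For an integer $n>0$, real quaternions $\mathbf{x},\mathbf{y}\in S^3$ and $z$ in the upper half-plane $\mathbb{H}$ put $$F_n(\mathbf{x},\mathbf{y};z)=\sum_{\mathbf{m}\in B(\mathbb{Z})}\mathrm{nr}(\mathbf{m})^{n/2}\,U_n\!\left(\frac{\mathrm{tr}(\mathbf{m}\mathbf{x}\overline{\mathbf{y}})}{2\sqrt{\mathrm{nr}(\mathbf{m})}}\right)e^{2\pi i\,\mathrm{nr}(\mathbf{m})z},$$ where the term $\mathbf{m}=0$ is read as $0$.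 For $\mathbf{x}\in S^3$ write $F_n(z)=F_n(\mathbf{x},\mathbf{x};z)$, and let $$\|F_n\|^2=\int_{\Gamma_0(4)\backslash\mathbb{H}}|F_n(z)|^2\,y^{n+2}\,\frac{dx\,dy}{y^2},\qquad z=x+iy,$$ be its squared Petersson norm as a form of weight $n+2$ on $\Gamma_0(4)$. Then for every $\varepsilon>0$ there is a constant $C_\varepsilon>0$, depending only on $\varepsilon$, such that for all even integers $n>0$ and all $\mathbf{x}\in S^3$ $$\|F_n\|^2\le C_\varepsilon\,(4\pi)^{-n}\,\Gamma(n+2)\,n^{1+\varepsilon}.$$ -/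

import Mathlib

open MeasureTheory
open scoped Pointwise MatrixGroups

noncomputable section

/-! ### Quaternions and the theta series -/

/-- The reduced trace `tr(x) = x + x̄` of a real quaternion, as a real number. -/
def redTr (x : Quaternion ℝ) : ℝ := (x + star x).re

/-- The reduced norm `nr(x) = x x̄` of a real quaternion, as a real number. -/
def redNr (x : Quaternion ℝ) : ℝ := (x * star x).re

/-- An integral quaternion `m₁ + m₂ i + m₃ j + m₄ k` with `mᵢ ∈ ℤ`, viewed as a real quaternion.
The ring of integral quaternions `B(ℤ)` is `Quaternion ℤ`. -/
def intQuat (m : Quaternion ℤ) : Quaternion ℝ :=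
  ⟨(m.re : ℝ), (m.imI : ℝ), (m.imJ : ℝ), (m.imK : ℝ)⟩

/-- The value `U_n(t)` of the `n`-th Chebyshev polynomial of the second kind,
`U_n(cos θ) = sin((n+1)θ) / sin θ`. -/
def chebU (n : ℕ) (t : ℝ) : ℝ := (Polynomial.Chebyshev.U ℝ (n : ℤ)).eval t

/-- The theta series
`F_n(x, y; z) = ∑_{m ∈ B(ℤ)} nr(m)^{n/2} U_n(tr(m x ȳ) / (2 √nr(m))) e(nr(m) z)`,
where `e(w) = exp(2πiw)`. For `n > 0` the term `m = 0` is `0`, since `0 ^ (n/2) = 0`. -/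
def thetaF (n : ℕ) (x y : Quaternion ℝ) (z : UpperHalfPlane) : ℂ :=
  ∑' m : Quaternion ℤ,
    ((redNr (intQuat m) ^ ((n : ℝ) / 2) *
        chebU n (1 / (2 * √(redNr (intQuat m))) * redTr (intQuat m * x * star y)) : ℝ) : ℂ) *
      Complex.exp (2 * Real.pi * Complex.I * ((redNr (intQuat m) : ℝ) : ℂ) * (z : ℂ))

/-! ### The Petersson norm -/

/-- A fundamental domain for a subgroup `Γ` of `SL(2, ℤ)` containing `-1`: the union of the
translates `γ⁻¹ 𝒟` of the standard fundamental domain `𝒟` of `SL(2, ℤ)`, where `γ` runs through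
representatives of the cosets `γ Γ`. -/
def fundDomain (Γ : Subgroup SL(2, ℤ)) : Set UpperHalfPlane :=
  ⋃ q : SL(2, ℤ) ⧸ Γ, {z | q.out • z ∈ ModularGroup.fd}

/-- The square of the Petersson norm of weight `k` on `Γ`,
`‖f‖² = ∫_{Γ \ ℍ} |f(z)|² y^k dx dy / y²`, for a function `f` with `|f(z)|² y^k` invariant under
`Γ`, and `-1 ∈ Γ`. As `volume` is `dx dy / y²` on the upper half-plane and
`petersson k f f z = |f(z)|² y^k ≥ 0`, this is the integral over a fundamental domain;
it takes values in `[0, ∞]`. -/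
def peterssonNormSq (Γ : Subgroup SL(2, ℤ)) (k : ℤ) (f : UpperHalfPlane → ℂ) : ENNReal :=
  ∫⁻ z in fundDomain Γ, ‖UpperHalfPlane.petersson k f f z‖ₑ

lemma volume_fd_diff_fdo : volume (ModularGroup.fd \ ModularGroup.fdo) = 0 := by
  rw [UpperHalfPlane.volume_def]
  apply withDensity_absolutelyContinuous
  rw [UpperHalfPlane.measurableEmbedding_coe.comap_apply]
  have hl : ∀ a : ℝ, volume {w : ℂ | w.re = a} = 0 := by
    intro a
    have := Complex.volume_preserving_equiv_real_prod.measure_preimage_equiv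
      (({a} : Set ℝ) ×ˢ (Set.univ : Set ℝ))
    rw [Measure.volume_eq_prod, Measure.prod_prod] at this
    simp only [Real.volume_singleton, zero_mul] at this
    refine measure_mono_null ?_ this
    intro w hw
    simpa using hw
  refine measure_mono_null (t := Metric.sphere (0 : ℂ) 1 ∪ ({w : ℂ | w.re = 1 / 2} ∪
    {w : ℂ | w.re = -(1 / 2)})) ?_ ?_
  · rintro _ ⟨z, ⟨⟨h1, h2⟩, h3⟩, rfl⟩
    by_cases h : Complex.normSq (z : ℂ) = 1
    · left
      rw [Complex.normSq_eq_norm_sq] at h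
      have h' : ‖(z : ℂ)‖ = 1 :=
        (pow_eq_one_iff_of_nonneg (norm_nonneg _) two_ne_zero).mp h
      simpa using h'
    · right
      have h4 : ¬ |z.re| < 1 / 2 := fun h4 => h3 ⟨lt_of_le_of_ne h1 (Ne.symm h), h4⟩
      have h5 : |z.re| = 1 / 2 := le_antisymm h2 (not_lt.mp h4)
      rcases (abs_eq (by norm_num)).mp h5 with h6 | h6
      · left; simpa using h6
      · right; simpa using h6
  · rw [measure_union_null_iff, measure_union_null_iff]
    exact ⟨Measure.addHaar_sphere _ _ _, hl _, hl _⟩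

/-- `fundDomain Γ` is a fundamental domain for the group of transformations of the upper half-plane
defined by `Γ`, that is for `Γ / {±1}`. -/
lemma isFundamentalDomain_fundDomain (Γ : Subgroup SL(2, ℤ)) (hΓ : -1 ∈ Γ) :
    IsFundamentalDomain (Γ.map (MulAction.toPermHom SL(2, ℤ) UpperHalfPlane)) (fundDomain Γ)
      (volume : Measure UpperHalfPlane) := by
  have hinv : ∀ (g : SL(2, ℤ)) (s : Set UpperHalfPlane), volume s = 0 →
      volume {z : UpperHalfPlane | g • z ∈ s} = 0 := by
    intro g s hs
    have : {z : UpperHalfPlane | g • z ∈ s}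
        = (Matrix.SpecialLinearGroup.mapGL ℝ g)⁻¹ • s := by
      ext z
      rw [Set.mem_inv_smul_set_iff]
      rfl
    rw [this, measure_smul, hs]
  have : Countable (Matrix (Fin 2) (Fin 2) ℤ) := inferInstanceAs (Countable (Fin 2 → Fin 2 → ℤ))
  have : Countable SL(2, ℤ) := Subtype.countable
  have : Countable (SL(2, ℤ) ⧸ Γ) := Quotient.countable
  constructor
  · refine MeasurableSet.nullMeasurableSet (MeasurableSet.iUnion fun q => ?_)
    refine (ModularGroup.isClosed_fd.preimage ?_).measurableSet
    exact continuous_const_smul (Matrix.SpecialLinearGroup.mapGL ℝ q.out)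
  · refine Filter.Eventually.of_forall fun z => ?_
    obtain ⟨g, hg⟩ := ModularGroup.exists_smul_mem_fd z
    obtain ⟨h, hh⟩ := QuotientGroup.mk_out_eq_mul Γ g
    refine ⟨⟨MulAction.toPermHom SL(2, ℤ) UpperHalfPlane (h⁻¹ : Γ),
      Subgroup.mem_map_of_mem _ (h⁻¹ : Γ).2⟩, ?_⟩
    refine Set.mem_iUnion.mpr ⟨(g : SL(2, ℤ) ⧸ Γ), ?_⟩
    rw [hh]
    change (g * (h : SL(2, ℤ))) • (((h⁻¹ : Γ) : SL(2, ℤ)) • z) ∈ ModularGroup.fd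
    rw [← mul_smul]
    simpa using hg
  · have key : ∀ (a b : Γ.map (MulAction.toPermHom SL(2, ℤ) UpperHalfPlane)), a ≠ b →
        ∀ z, z ∈ a • fundDomain Γ → z ∈ b • fundDomain Γ →
        ∃ g : SL(2, ℤ), z ∈ {z : UpperHalfPlane | g • z ∈ ModularGroup.fd \ ModularGroup.fdo} := by
      rintro ⟨_, α, hα, rfl⟩ ⟨_, β, hβ, rfl⟩ hab z hza hzb
      rw [Set.mem_smul_set_iff_inv_smul_mem] at hza hzb
      obtain ⟨q, hq⟩ := Set.mem_iUnion.mp hza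
      obtain ⟨r, hr⟩ := Set.mem_iUnion.mp hzb
      have hq' : (q.out * α⁻¹) • z ∈ ModularGroup.fd := by
        rw [mul_smul]; exact hq
      have hr' : (r.out * β⁻¹) • z ∈ ModularGroup.fd := by
        rw [mul_smul]; exact hr
      refine ⟨q.out * α⁻¹, hq', fun ho => hab ?_⟩
      have h1 : ((r.out * β⁻¹) * (q.out * α⁻¹)⁻¹) • ((q.out * α⁻¹) • z) ∈ ModularGroup.fd := by
        rw [← mul_smul, inv_mul_cancel_right]; exact hr'
      obtain ⟨ε, hε, hε1, hεz⟩ : ∃ ε : SL(2, ℤ), ε ∈ Γ ∧ r.out * β⁻¹ = q.out * α⁻¹ * ε ∧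
          ∀ w : UpperHalfPlane, ε • w = w := by
        rcases ModularGroup.eq_one_or_neg_one_of_mem_fdo_mem_fd ho h1 with h | h
        · refine ⟨1, Γ.one_mem, ?_, fun w => one_smul _ w⟩
          rw [mul_one]; exact mul_inv_eq_one.mp h
        · refine ⟨-1, hΓ, ?_, fun w => by simp⟩
          rw [mul_inv_eq_iff_eq_mul] at h
          rw [h]; simp
      have h2 : q = r := by
        have : ((q.out : SL(2, ℤ)) : SL(2, ℤ) ⧸ Γ) = (r.out : SL(2, ℤ)) := by
          rw [QuotientGroup.eq]
          have : q.out⁻¹ * r.out = α⁻¹ * ε * β := by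
            rw [mul_inv_eq_iff_eq_mul] at hε1
            rw [hε1]; group
          rw [this]
          exact Γ.mul_mem (Γ.mul_mem (Γ.inv_mem hα) hε) hβ
        simpa using this
      subst h2
      have h3 : β⁻¹ = α⁻¹ * ε := by
        rw [mul_assoc] at hε1
        exact mul_left_cancel hε1
      have h4 : α = ε * β := by
        have : β = ε⁻¹ * α := by rw [← inv_inv β, h3]; group
        rw [this]; group
      apply Subtype.ext
      apply Equiv.ext
      intro w
      change α • w = β • w
      rw [h4, mul_smul, hεz]
    intro a b hab
    refine measure_mono_null (t := ⋃ g : SL(2, ℤ),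
      {z : UpperHalfPlane | g • z ∈ ModularGroup.fd \ ModularGroup.fdo}) ?_ ?_
    · rintro z ⟨h1, h2⟩
      exact Set.mem_iUnion.mpr (key a b hab z h1 h2)
    · exact measure_iUnion_null fun g => hinv g _ volume_fd_diff_fdo

end

/-!
The diagonal series `F_n(x, x; z)` does not depend on `x`, since `tr (m x x̄) = tr m`. The
exponentials in it have as coefficients the values `zonal n (2 m₀) (nr m)` of a zonal harmonic
polynomial, so `F_n` is, up to the factor `2⁻ⁿ`, one of the theta series `thetaMod n φ` attached to
a weight `φ` on `(ℤ/2)⁴` (`thetaF_self`).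

These theta series are stable under `SL(2, ℤ)` up to the automorphy factor. Translations only change
the weight. For the inversion, the zonal polynomial is the character of a symmetric power of the
two-dimensional representation of the quaternions, hence a linear combination of `n`-th powers of
isotropic linear forms (`exists_zonal_eq_sum_pow`). For an isotropic form `w` the series
`∑ exp (t w(m)) e(|m|² τ / 2)` is a product of four Jacobi theta functions in whose functional
equations the Gaussian factors in `t` cancel, and comparison of Taylor coefficients in `t` gives the
transformation formula (`tsum_pow_isotropic`, `tsum_zonal`). The action on the weights does not
depend on `n` (`exists_thetaMod_smul`). Therefore the Petersson norm is a sum over the finitely many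
cosets of `Γ₀(4)` of integrals of `|thetaMod n φ|² y ^ (n + 2)` over the standard fundamental domain,
with finitely many weights `φ` that are the same for all `n`.

The fundamental domain lies in the strip `-2 < x ≤ 2`, `1 / 2 ≤ y`, where Parseval's identity turns
each integral into a sum over `l` of `|c_l|²` times `∫ yⁿ exp (-π l y) dy` (`lintegral_thetaMod_le`).
The coefficient `c_l` is at most `l ^ (n / 2)` times the sum of `|U_n|` over the representations of
`l` by four squares. As `|U_n (cos θ) sin θ| ≤ 1` and a number `k` has `O(k ^ (1 / 2 + ε))`
representations by three squares, that sum is `O(l ^ (1 + ε))`, apart from a term `2 (n + 1)` when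
`l` is a square (`exists_sum_abs_chebU_le`). Inserting the factor `(2 y) ^ A ≥ 1` into the integral
over `y`, with `A = 2 + δ` for the generic part and `A = 0` for the squares, makes both sums over `l`
converge and gives `π ^ (-n) Γ(n + 2) n ^ (1 + δ)` (`sq_mul_cuspWeight_le`).
-/

/-! ### The divisor bound and sums of squares -/

/-- The divisor bound. In `d(k) = ∏ (a + 1)` over the prime powers `p ^ a` exactly dividing `k`, each
factor with `2 ≤ p ^ ε` is at most `(p ^ a) ^ ε`; the finitely many other primes contribute a
constant. -/
theorem exists_card_divisors_le_rpow {ε : ℝ} (hε : 0 < ε) :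
    ∃ C : ℝ, 1 ≤ C ∧ ∀ k : ℕ, k ≠ 0 → (k.divisors.card : ℝ) ≤ C * (k : ℝ) ^ ε := by
  set K : ℝ := 1 + 1 / (ε * Real.log 2) with hK
  have hlog : 0 < Real.log 2 := Real.log_pos one_lt_two
  have hK1 : 1 ≤ K := by
    have : 0 ≤ 1 / (ε * Real.log 2) := by positivity
    linarith
  set M : ℕ := ⌈(2 : ℝ) ^ (1 / ε)⌉₊ with hM
  refine ⟨K ^ M, one_le_pow₀ hK1, fun k hk => ?_⟩
  have hprime : ∀ p ∈ k.primeFactors, ((k.factorization p + 1 : ℕ) : ℝ) ≤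
      (if p < M then K else 1) * ((p : ℝ) ^ k.factorization p) ^ ε := by
    intro p hp
    have hp2 : (2 : ℝ) ≤ p := by exact_mod_cast (Nat.prime_of_mem_primeFactors hp).two_le
    generalize k.factorization p = a
    have hpow : ((p : ℝ) ^ a) ^ ε = ((p : ℝ) ^ ε) ^ a := by
      rw [← Real.rpow_natCast, ← Real.rpow_mul (by linarith), mul_comm,
        Real.rpow_mul (by linarith), Real.rpow_natCast]
    rw [hpow]
    split_ifs with h
    · have h1 : (2 : ℝ) ^ ε ≤ (p : ℝ) ^ ε := Real.rpow_le_rpow (by norm_num) hp2 hε.le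
      have h2 : 1 + ε * Real.log 2 ≤ (2 : ℝ) ^ ε := by
        rw [Real.rpow_def_of_pos two_pos]
        linarith [Real.add_one_le_exp (Real.log 2 * ε)]
      have h3 : 1 + (a : ℝ) * (ε * Real.log 2) ≤ ((p : ℝ) ^ ε) ^ a := by
        refine (one_add_mul_le_pow (by nlinarith [mul_pos hε hlog]) a).trans ?_
        gcongr
        linarith
      calc ((a + 1 : ℕ) : ℝ) ≤ K * (1 + (a : ℝ) * (ε * Real.log 2)) := by
            rw [hK]
            have : 0 < ε * Real.log 2 := by positivity
            have h4 : (1 + 1 / (ε * Real.log 2)) * (1 + (a : ℝ) * (ε * Real.log 2)) =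
              1 + a + a * (ε * Real.log 2) + 1 / (ε * Real.log 2) := by field_simp; ring
            rw [h4]; push_cast
            have : 0 ≤ (a : ℝ) * (ε * Real.log 2) := by positivity
            have : 0 ≤ 1 / (ε * Real.log 2) := by positivity
            linarith
        _ ≤ _ := by gcongr
    · have h1 : (2 : ℝ) ≤ (p : ℝ) ^ ε := by
        have h2 : (2 : ℝ) ^ (1 / ε) ≤ p := (Nat.le_ceil _).trans (by exact_mod_cast not_lt.mp h)
        have h3 := Real.rpow_le_rpow (by positivity) h2 hε.le
        rwa [← Real.rpow_mul (by norm_num), one_div, inv_mul_cancel₀ hε.ne', Real.rpow_one] at h3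
      calc ((a + 1 : ℕ) : ℝ) ≤ (2 : ℝ) ^ a := by exact_mod_cast Nat.lt_two_pow_self
        _ ≤ 1 * ((p : ℝ) ^ ε) ^ a := by rw [one_mul]; gcongr
  rw [Nat.card_divisors hk, Nat.cast_prod]
  calc ∏ p ∈ k.primeFactors, ((k.factorization p + 1 : ℕ) : ℝ)
      ≤ ∏ p ∈ k.primeFactors, (if p < M then K else 1) * ((p : ℝ) ^ k.factorization p) ^ ε :=
        Finset.prod_le_prod (fun _ _ => by positivity) hprime
    _ = (∏ p ∈ k.primeFactors, if p < M then K else 1) * (k : ℝ) ^ ε := by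
        rw [Finset.prod_mul_distrib, Real.finsetProd_rpow _ _ (fun _ _ => by positivity)]
        congr 2
        conv_rhs => rw [← Nat.prod_factorization_pow_eq_self hk]
        rw [Finsupp.prod, Nat.cast_prod, Nat.support_factorization]
        simp
    _ ≤ K ^ M * (k : ℝ) ^ ε := by
        gcongr
        rw [Finset.prod_ite, Finset.prod_const, Finset.prod_const_one, mul_one]
        refine pow_le_pow_right₀ hK1 ?_
        calc _ ≤ (Finset.range M).card := Finset.card_le_card fun p hp => by
                simpa using (Finset.mem_filter.mp hp).2
          _ = M := Finset.card_range M

/-- The representations of `k` as a sum of two squares. The search box is no restriction, see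
`mem_twoSquares`. -/
noncomputable def twoSquares (k : ℤ) : Finset (ℤ × ℤ) :=
  (Finset.Icc (-k) k ×ˢ Finset.Icc (-k) k).filter fun p => p.1 ^ 2 + p.2 ^ 2 = k

/-- The representations of `k` as a sum of three squares. -/
noncomputable def threeSquares (k : ℤ) : Finset (ℤ × ℤ × ℤ) :=
  (Finset.Icc (-k) k ×ˢ Finset.Icc (-k) k ×ˢ Finset.Icc (-k) k).filter
    fun p => p.1 ^ 2 + p.2.1 ^ 2 + p.2.2 ^ 2 = k

/-- The representations of `k` as a sum of four squares. -/
noncomputable def fourSquares (k : ℤ) : Finset (ℤ × ℤ × ℤ × ℤ) :=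
  (Finset.Icc (-k) k ×ˢ Finset.Icc (-k) k ×ˢ Finset.Icc (-k) k ×ˢ Finset.Icc (-k) k).filter
    fun p => p.1 ^ 2 + p.2.1 ^ 2 + p.2.2.1 ^ 2 + p.2.2.2 ^ 2 = k

lemma mem_Icc_of_sq_le {a k : ℤ} (h : a ^ 2 ≤ k) : a ∈ Finset.Icc (-k) k := by
  rw [Finset.mem_Icc, ← abs_le]
  rcases eq_or_ne a 0 with rfl | ha
  · simpa using h
  · have := Int.one_le_abs ha
    nlinarith [sq_abs a]

lemma mem_twoSquares {k : ℤ} {p : ℤ × ℤ} : p ∈ twoSquares k ↔ p.1 ^ 2 + p.2 ^ 2 = k := by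
  rw [twoSquares, Finset.mem_filter, and_iff_right_iff_imp]
  intro h
  simp only [Finset.mem_product]
  refine ⟨mem_Icc_of_sq_le ?_, mem_Icc_of_sq_le ?_⟩ <;> nlinarith [sq_nonneg p.1, sq_nonneg p.2]

lemma mem_threeSquares {k : ℤ} {p : ℤ × ℤ × ℤ} :
    p ∈ threeSquares k ↔ p.1 ^ 2 + p.2.1 ^ 2 + p.2.2 ^ 2 = k := by
  rw [threeSquares, Finset.mem_filter, and_iff_right_iff_imp]
  intro h
  simp only [Finset.mem_product]
  refine ⟨mem_Icc_of_sq_le ?_, mem_Icc_of_sq_le ?_, mem_Icc_of_sq_le ?_⟩ <;>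
    nlinarith [sq_nonneg p.1, sq_nonneg p.2.1, sq_nonneg p.2.2]

lemma mem_fourSquares {k : ℤ} {p : ℤ × ℤ × ℤ × ℤ} :
    p ∈ fourSquares k ↔ p.1 ^ 2 + p.2.1 ^ 2 + p.2.2.1 ^ 2 + p.2.2.2 ^ 2 = k := by
  rw [fourSquares, Finset.mem_filter, and_iff_right_iff_imp]
  intro h
  simp only [Finset.mem_product]
  refine ⟨mem_Icc_of_sq_le ?_, mem_Icc_of_sq_le ?_, mem_Icc_of_sq_le ?_, mem_Icc_of_sq_le ?_⟩ <;>
    nlinarith [sq_nonneg p.1, sq_nonneg p.2.1, sq_nonneg p.2.2.1, sq_nonneg p.2.2.2]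

lemma isCoprime_left_of_sq_add_sq {k a b : ℤ} (hab : IsCoprime a b) (h : a ^ 2 + b ^ 2 = k) :
    IsCoprime a k := by
  rw [← h]
  have : IsCoprime a (b ^ 2 + a * a) := (hab.pow_right (n := 2)).add_mul_left_right a
  convert this using 1; ring

lemma isCoprime_right_of_sq_add_sq {k a b : ℤ} (hab : IsCoprime a b) (h : a ^ 2 + b ^ 2 = k) :
    IsCoprime b k :=
  isCoprime_left_of_sq_add_sq hab.symm (by rw [← h]; ring)

lemma dvd_cross_of_dvd {e a b a' b' a₀ b₀ : ℤ} (he : IsCoprime b₀ e)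
    (h : e ∣ a * b₀ - a₀ * b) (h' : e ∣ a' * b₀ - a₀ * b') : e ∣ a * b' - a' * b := by
  refine he.symm.dvd_of_dvd_mul_left (y := b₀) ?_
  have : b₀ * (a * b' - a' * b) = b' * (a * b₀ - a₀ * b) - b * (a' * b₀ - a₀ * b') := by ring
  rw [this]
  exact dvd_sub (h.mul_left _) (h'.mul_left _)

/-- Two primitive representations of `k` having the same greatest common divisor of `k` and
their cross product with a fixed third one differ by a unit of the Gaussian integers. -/
lemma eq_unit_mul_of_gcd_eq {k a b a' b' a₀ b₀ : ℤ} (hk : 0 < k)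
    (hc : IsCoprime a b) (hc₀ : IsCoprime a₀ b₀)
    (h : a ^ 2 + b ^ 2 = k) (h' : a' ^ 2 + b' ^ 2 = k) (h₀ : a₀ ^ 2 + b₀ ^ 2 = k)
    (hg : Int.gcd k (a * b₀ - a₀ * b) = Int.gcd k (a' * b₀ - a₀ * b')) :
    (a', b') ∈ ({(a, b), (-a, -b), (-b, a), (b, -a)} : Finset (ℤ × ℤ)) := by
  have hb₀ : IsCoprime b₀ k := isCoprime_right_of_sq_add_sq hc₀ h₀
  have ha : IsCoprime a k := isCoprime_left_of_sq_add_sq hc h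
  set d : ℤ := (Int.gcd k (a * b₀ - a₀ * b) : ℤ) with hd
  have hdk : d ∣ k := Int.gcd_dvd_left _ _
  obtain ⟨e, he⟩ := hdk
  have hd0 : d ≠ 0 := by rintro h0; rw [h0] at he; simp at he; omega
  -- the cofactor `e` of `d` divides the other factor of `k (a² - a₀²)`
  have hcof : ∀ u v : ℤ, u ^ 2 + v ^ 2 = k → d = Int.gcd k (u * b₀ - a₀ * v) →
      e ∣ u * b₀ + a₀ * v := by
    intro u v huv hduv
    obtain ⟨X, hX⟩ : d ∣ u * b₀ - a₀ * v := by rw [hduv]; exact Int.gcd_dvd_right _ _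
    have hcop : IsCoprime e X := by
      have h1 := Int.gcd_div_gcd_div_gcd (i := k) (j := u * b₀ - a₀ * v)
        (by rw [Int.gcd_pos_iff]; left; omega)
      rw [← hduv, hX, he, Int.mul_ediv_cancel_left _ hd0, Int.mul_ediv_cancel_left _ hd0] at h1
      exact Int.isCoprime_iff_gcd_eq_one.mpr h1
    refine hcop.dvd_of_dvd_mul_left (y := X) ⟨u ^ 2 - a₀ ^ 2, ?_⟩
    apply mul_left_cancel₀ hd0
    have : d * (X * (u * b₀ + a₀ * v)) = (u * b₀ - a₀ * v) * (u * b₀ + a₀ * v) := by rw [hX]; ring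
    rw [this, ← mul_assoc, ← he]
    have e1 : b₀ ^ 2 = k - a₀ ^ 2 := by linarith
    have e2 : v ^ 2 = k - u ^ 2 := by linarith
    linear_combination u ^ 2 * e1 - a₀ ^ 2 * e2
  have hd1 : d ∣ a * b' - a' * b :=
    dvd_cross_of_dvd (hb₀.of_isCoprime_of_dvd_right ⟨e, he⟩)
      (Int.gcd_dvd_right _ _) (by rw [hd, hg]; exact Int.gcd_dvd_right _ _)
  have hX : d ∣ a * b₀ - a₀ * b := Int.gcd_dvd_right _ _
  have hY := hcof a b h rfl
  have he1 : e ∣ a * b' - a' * b := by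
    refine dvd_cross_of_dvd (a₀ := -a₀) (hb₀.of_isCoprime_of_dvd_right ⟨d, by rw [he]; ring⟩)
      (by simpa using hY) ?_
    simpa using hcof a' b' h' (by rw [hd, hg])
  -- `gcd d e` divides `2`
  have hgcd : gcd d e ∣ 2 := by
    have h1 : gcd d e ∣ 2 * (a * b₀) := by
      have : 2 * (a * b₀) = (a * b₀ - a₀ * b) + (a * b₀ + a₀ * b) := by ring
      rw [this]
      exact dvd_add ((gcd_dvd_left d e).trans hX) ((gcd_dvd_right d e).trans hY)
    have h2 : IsCoprime (a * b₀) (gcd d e) :=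
      (ha.mul_left hb₀).of_isCoprime_of_dvd_right ((gcd_dvd_left d e).trans ⟨e, he⟩)
    exact h2.symm.dvd_of_dvd_mul_right h1
  have hk2 : k ∣ 2 * (a * b' - a' * b) := by
    have h1 : lcm d e ∣ a * b' - a' * b := lcm_dvd hd1 he1
    have h2 : k ∣ gcd d e * lcm d e := by rw [he]; exact (gcd_mul_lcm d e).symm.dvd
    exact h2.trans (mul_dvd_mul hgcd h1)
  obtain ⟨t, ht⟩ := hk2
  set D := a * b' - a' * b with hD
  set E := a * a' + b * b' with hE
  have hDE : D ^ 2 + E ^ 2 = k ^ 2 := by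
    have : D ^ 2 + E ^ 2 = (a ^ 2 + b ^ 2) * (a' ^ 2 + b' ^ 2) := by rw [hD, hE]; ring
    rw [this, h, h']; ring
  have ht4 : t ^ 2 ≤ 4 := by
    have : k ^ 2 * t ^ 2 ≤ k ^ 2 * 4 := by
      have : (2 * D) ^ 2 = k ^ 2 * t ^ 2 := by rw [ht]; ring
      nlinarith [sq_nonneg E]
    exact le_of_mul_le_mul_left this (by positivity)
  have ha' : k * a' = a * E - b * D := by rw [← h, hD, hE]; ring
  have hb' : k * b' = b * E + a * D := by rw [← h, hD, hE]; ring
  have ht2 : -2 ≤ t ∧ t ≤ 2 := ⟨by nlinarith, by nlinarith⟩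
  have hcan : ∀ {u v : ℤ}, k * u = k * v → u = v := fun huv => mul_left_cancel₀ hk.ne' huv
  simp only [Finset.mem_insert, Finset.mem_singleton, Prod.mk.injEq]
  -- an odd `t` would make `3` a square
  have hodd : t ^ 2 ≠ 1 := by
    intro h1
    have h3 : (2 * E) ^ 2 = 3 * k ^ 2 := by
      have : (2 * D) ^ 2 = k ^ 2 := by rw [ht, mul_pow, h1, mul_one]
      linarith
    have h5 : 2 * E.natAbs * (2 * E.natAbs) = 3 * (k.natAbs * k.natAbs) := by
      zify; rw [← sq, mul_pow, sq_abs, ← sq, sq_abs]; linarith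
    have := (Nat.Prime.irrational_sqrt Nat.prime_three)
    apply this
    refine ⟨(2 * E.natAbs : ℕ) / (k.natAbs : ℕ), ?_⟩
    have hkn : (0 : ℝ) < k.natAbs := by
      have : 0 < k.natAbs := Int.natAbs_pos.mpr hk.ne'
      exact_mod_cast this
    push_cast
    symm
    rw [Real.sqrt_eq_iff_mul_self_eq (by norm_num) (by positivity)]
    field_simp
    have h6 : ((2 * E.natAbs * (2 * E.natAbs) : ℕ) : ℝ) = (3 * (k.natAbs * k.natAbs) : ℕ) := by
      rw [h5]
    push_cast at h6
    linarith
  have hcases : t = 0 ∨ t = 2 ∨ t = -2 := by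
    have : t = 0 ∨ t = 2 ∨ t = -2 ∨ t = 1 ∨ t = -1 := by omega
    rcases this with h1 | h1 | h1 | h1 | h1
    · exact Or.inl h1
    · exact Or.inr (Or.inl h1)
    · exact Or.inr (Or.inr h1)
    · exact absurd (by rw [h1]; norm_num) hodd
    · exact absurd (by rw [h1]; norm_num) hodd
  rcases hcases with rfl | rfl | rfl
  · have hD0 : D = 0 := by linarith
    have hE2 : E ^ 2 = k ^ 2 := by rw [hD0] at hDE; linarith
    rcases sq_eq_sq_iff_eq_or_eq_neg.mp hE2 with hE1 | hE1
    · left; rw [hD0, hE1] at ha' hb'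
      exact ⟨hcan (by linarith), hcan (by linarith)⟩
    · right; left; rw [hD0, hE1] at ha' hb'
      exact ⟨hcan (by linarith), hcan (by linarith)⟩
  · have hD0 : D = k := by linarith
    have hE0 : E = 0 := by rw [hD0] at hDE; exact pow_eq_zero_iff two_ne_zero |>.mp (by linarith)
    right; right; left; rw [hD0, hE0] at ha' hb'
    exact ⟨hcan (by linarith), hcan (by linarith)⟩
  · have hD0 : D = -k := by linarith
    have hE0 : E = 0 := by
      rw [hD0] at hDE; exact pow_eq_zero_iff two_ne_zero |>.mp (by linarith [neg_sq k])
    right; right; right; rw [hD0, hE0] at ha' hb'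
    exact ⟨hcan (by linarith), hcan (by linarith)⟩

/-- A primitive representation is determined up to the four Gaussian units by a divisor of `k`. -/
lemma card_primitive_twoSquares_le {k : ℕ} (hk : k ≠ 0) :
    ((twoSquares k).filter fun p => IsCoprime p.1 p.2).card ≤ 4 * k.divisors.card := by
  set T := (twoSquares k).filter fun p => IsCoprime p.1 p.2 with hT
  have hmem : ∀ p ∈ T, p.1 ^ 2 + p.2 ^ 2 = (k : ℤ) ∧ IsCoprime p.1 p.2 := fun p hp => by
    rw [hT, Finset.mem_filter, mem_twoSquares] at hp; exact hp
  rcases T.eq_empty_or_nonempty with h | ⟨⟨a₀, b₀⟩, hz₀⟩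
  · simp [h]
  set g : ℤ × ℤ → ℕ := fun p => Int.gcd k (p.1 * b₀ - a₀ * p.2) with hg
  have h1 : T.card ≤ 4 * (T.image g).card := by
    refine Finset.card_le_mul_card_image T 4 fun d hd => ?_
    obtain ⟨⟨a, b⟩, hz, rfl⟩ := Finset.mem_image.mp hd
    refine (Finset.card_le_card (t := {(a, b), (-a, -b), (-b, a), (b, -a)}) ?_).trans
      Finset.card_le_four
    rintro ⟨a', b'⟩ hz'
    rw [Finset.mem_filter] at hz'
    exact eq_unit_mul_of_gcd_eq (by omega) (hmem _ hz).2 (hmem _ hz₀).2 (hmem _ hz).1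
      (hmem _ hz'.1).1 (hmem _ hz₀).1 hz'.2.symm
  refine h1.trans (Nat.mul_le_mul_left 4 (Finset.card_le_card fun d hd => ?_))
  obtain ⟨p, -, rfl⟩ := Finset.mem_image.mp hd
  rw [Nat.mem_divisors]
  exact ⟨by exact_mod_cast Int.gcd_dvd_left (k : ℤ) (p.1 * b₀ - a₀ * p.2), hk⟩

/-- Dividing by the greatest common divisor reduces the count to primitive representations. -/
lemma card_twoSquares_le {k : ℕ} (hk : k ≠ 0) :
    (twoSquares k).card ≤ 4 * k.divisors.card ^ 2 := by
  have hmaps : ∀ p ∈ twoSquares k, Int.gcd p.1 p.2 ∈ k.divisors := by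
    intro p hp
    rw [mem_twoSquares] at hp
    rw [Nat.mem_divisors]
    refine ⟨?_, hk⟩
    have : ((Int.gcd p.1 p.2 : ℕ) : ℤ) ∣ k := by
      rw [← hp]
      exact dvd_add ((Int.gcd_dvd_left _ _).trans (dvd_pow_self _ two_ne_zero))
        ((Int.gcd_dvd_right _ _).trans (dvd_pow_self _ two_ne_zero))
    exact_mod_cast this
  have hfib : ∀ g ∈ k.divisors,
      ((twoSquares k).filter fun p => Int.gcd p.1 p.2 = g).card ≤ 4 * k.divisors.card := by
    intro g hg
    have hg0 : g ≠ 0 := (Nat.pos_of_mem_divisors hg).ne'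
    by_cases hgk : g ^ 2 ∣ k
    swap
    · rw [Finset.card_eq_zero.mpr]
      · omega
      rw [Finset.filter_eq_empty_iff]
      rintro ⟨a, b⟩ hp hgcd
      apply hgk
      rw [mem_twoSquares] at hp
      have h1 : (g : ℤ) ∣ a := by rw [← hgcd]; exact Int.gcd_dvd_left _ _
      have h2 : (g : ℤ) ∣ b := by rw [← hgcd]; exact Int.gcd_dvd_right _ _
      have : (g : ℤ) ^ 2 ∣ k := by
        rw [← hp]; exact dvd_add (pow_dvd_pow_of_dvd h1 2) (pow_dvd_pow_of_dvd h2 2)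
      exact_mod_cast this
    obtain ⟨k₁, rfl⟩ := hgk
    have hk₁ : k₁ ≠ 0 := by rintro rfl; simp at hk
    calc _ ≤ ((twoSquares k₁).filter fun p => IsCoprime p.1 p.2).card := by
          refine Finset.card_le_card_of_injOn (fun p => (p.1 / g, p.2 / g)) ?_ ?_
          · rintro ⟨a, b⟩ hp
            simp only [Finset.coe_filter, Set.mem_ofPred_eq, mem_twoSquares] at hp ⊢
            obtain ⟨hp, hgcd⟩ := hp
            have h1 : (g : ℤ) ∣ a := by rw [← hgcd]; exact Int.gcd_dvd_left _ _
            have h2 : (g : ℤ) ∣ b := by rw [← hgcd]; exact Int.gcd_dvd_right _ _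
            constructor
            · obtain ⟨u, rfl⟩ := h1
              obtain ⟨v, rfl⟩ := h2
              have hg0' : (g : ℤ) ≠ 0 := by exact_mod_cast hg0
              rw [Int.mul_ediv_cancel_left _ hg0', Int.mul_ediv_cancel_left _ hg0']
              apply mul_left_cancel₀ (pow_ne_zero 2 hg0')
              push_cast at hp
              linarith
            · rw [Int.isCoprime_iff_gcd_eq_one, ← hgcd]
              exact Int.gcd_div_gcd_div_gcd (by rw [hgcd]; omega)
          · rintro ⟨a, b⟩ hp ⟨a', b'⟩ hp' heq
            simp only [Finset.coe_filter, Set.mem_ofPred_eq, Prod.mk.injEq] at hp hp' heq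
            have h1 : (g : ℤ) ∣ a := by rw [← hp.2]; exact Int.gcd_dvd_left _ _
            have h2 : (g : ℤ) ∣ b := by rw [← hp.2]; exact Int.gcd_dvd_right _ _
            have h1' : (g : ℤ) ∣ a' := by rw [← hp'.2]; exact Int.gcd_dvd_left _ _
            have h2' : (g : ℤ) ∣ b' := by rw [← hp'.2]; exact Int.gcd_dvd_right _ _
            rw [Prod.mk.injEq, ← Int.ediv_mul_cancel h1, heq.1, Int.ediv_mul_cancel h1',
              ← Int.ediv_mul_cancel h2, heq.2, Int.ediv_mul_cancel h2']
            exact ⟨rfl, rfl⟩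
      _ ≤ 4 * k₁.divisors.card := card_primitive_twoSquares_le hk₁
      _ ≤ 4 * (g ^ 2 * k₁).divisors.card :=
          Nat.mul_le_mul_left 4 (Finset.card_le_card
            (Nat.divisors_subset_of_dvd hk (Dvd.intro_left _ rfl)))
  calc (twoSquares k).card
      = ∑ g ∈ k.divisors, ((twoSquares k).filter fun p => Int.gcd p.1 p.2 = g).card :=
        Finset.card_eq_sum_card_fiberwise hmaps
    _ ≤ ∑ _g ∈ k.divisors, 4 * k.divisors.card := Finset.sum_le_sum hfib
    _ = 4 * k.divisors.card ^ 2 := by rw [Finset.sum_const, smul_eq_mul]; ring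

/-- A bound for the number of representations by two squares which is uniform in `k ≤ K`; it covers
`k ≤ 0`, which occurs when the other coordinates are fixed. -/
lemma exists_card_twoSquares_le {ε : ℝ} (hε : 0 < ε) :
    ∃ C : ℝ, 1 ≤ C ∧ ∀ k K : ℤ, k ≤ K → 1 ≤ K → ((twoSquares k).card : ℝ) ≤ C * (K : ℝ) ^ ε := by
  obtain ⟨C, hC, h⟩ := exists_card_divisors_le_rpow (half_pos hε)
  refine ⟨4 * C ^ 2, by nlinarith, fun k K hkK hK => ?_⟩
  have hK1 : (1 : ℝ) ≤ K := by exact_mod_cast hK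
  have hKε : 1 ≤ (K : ℝ) ^ ε := Real.one_le_rpow hK1 hε.le
  rcases lt_trichotomy k 0 with hk | rfl | hk
  · have : twoSquares k = ∅ := by
      refine Finset.eq_empty_of_forall_notMem fun p hp => ?_
      rw [mem_twoSquares] at hp
      nlinarith [sq_nonneg p.1, sq_nonneg p.2]
    rw [this]; simp; positivity
  · have : (twoSquares 0).card = 1 := by decide
    rw [this]
    push_cast
    nlinarith
  · lift k to ℕ using hk.le
    have hk0 : k ≠ 0 := by omega
    have h1 : ((twoSquares k).card : ℝ) ≤ 4 * (k.divisors.card : ℝ) ^ 2 := by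
      exact_mod_cast card_twoSquares_le hk0
    calc ((twoSquares k).card : ℝ) ≤ 4 * (k.divisors.card : ℝ) ^ 2 := h1
      _ ≤ 4 * (C * (k : ℝ) ^ (ε / 2)) ^ 2 := by gcongr; exact h k hk0
      _ = 4 * C ^ 2 * (k : ℝ) ^ ε := by
        rw [mul_pow, ← Real.rpow_natCast ((k : ℝ) ^ (ε / 2)), ← Real.rpow_mul (by positivity)]
        norm_num; ring
      _ ≤ 4 * C ^ 2 * (K : ℝ) ^ ε := by
        gcongr
        exact_mod_cast hkK

lemma mem_Icc_natSqrt_iff {a : ℤ} {k : ℕ} :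
    a ∈ Finset.Icc (-(Nat.sqrt k : ℤ)) (Nat.sqrt k) ↔ a ^ 2 ≤ k := by
  rw [Finset.mem_Icc, ← abs_le, Int.abs_eq_natAbs]
  norm_cast
  rw [Nat.le_sqrt', ← Int.natAbs_sq]
  norm_cast

lemma card_Icc_natSqrt_le {k : ℕ} (hk : k ≠ 0) :
    ((Finset.Icc (-(Nat.sqrt k : ℤ)) (Nat.sqrt k)).card : ℝ) ≤ 3 * √k := by
  have h1 : (Finset.Icc (-(Nat.sqrt k : ℤ)) (Nat.sqrt k)).card = 2 * Nat.sqrt k + 1 := by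
    rw [Int.card_Icc]; omega
  have h2 : (Nat.sqrt k : ℝ) ≤ √k := Real.nat_sqrt_le_real_sqrt
  have h3 : (1 : ℝ) ≤ √k := by
    rw [Real.one_le_sqrt]; exact_mod_cast Nat.one_le_iff_ne_zero.mpr hk
  rw [h1]; push_cast; linarith

lemma exists_card_threeSquares_le {ε : ℝ} (hε : 0 < ε) :
    ∃ C : ℝ, 1 ≤ C ∧ ∀ k : ℕ, k ≠ 0 →
      ((threeSquares k).card : ℝ) ≤ C * √k * (k : ℝ) ^ ε := by
  obtain ⟨C, hC, h⟩ := exists_card_twoSquares_le hε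
  refine ⟨3 * C, by linarith, fun k hk => ?_⟩
  set I := Finset.Icc (-(Nat.sqrt k : ℤ)) (Nat.sqrt k) with hI
  have hmaps : ∀ p ∈ threeSquares k, p.1 ∈ I := by
    intro p hp
    rw [mem_threeSquares] at hp
    rw [hI, mem_Icc_natSqrt_iff]
    nlinarith [sq_nonneg p.2.1, sq_nonneg p.2.2]
  have hfib : ∀ a ∈ I, (((threeSquares k).filter fun p => p.1 = a).card : ℝ) ≤
      C * (k : ℝ) ^ ε := by
    intro a _
    refine le_trans ?_ (h (k - a ^ 2) k (by nlinarith [sq_nonneg a]) (by omega))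
    rw [Nat.cast_le]
    refine Finset.card_le_card_of_injOn (fun p => p.2) ?_ ?_
    · rintro ⟨a', b, c⟩ hp
      simp only [Finset.coe_filter, Set.mem_ofPred_eq, mem_threeSquares, Finset.mem_coe,
        mem_twoSquares] at hp ⊢
      rw [← hp.1, ← hp.2]; ring
    · rintro ⟨a', q⟩ hp ⟨a'', q'⟩ hp' heq
      simp only [Finset.coe_filter, Set.mem_ofPred_eq] at hp hp' heq
      rw [hp.2, hp'.2, heq]
  calc ((threeSquares k).card : ℝ)
      = ∑ a ∈ I, (((threeSquares k).filter fun p => p.1 = a).card : ℝ) := by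
        rw [Finset.card_eq_sum_card_fiberwise hmaps]; push_cast; rfl
    _ ≤ ∑ _a ∈ I, C * (k : ℝ) ^ ε := Finset.sum_le_sum hfib
    _ = I.card * (C * (k : ℝ) ^ ε) := by rw [Finset.sum_const, nsmul_eq_mul]
    _ ≤ 3 * √k * (C * (k : ℝ) ^ ε) := by
        gcongr
        exact card_Icc_natSqrt_le hk
    _ = _ := by ring

/-! ### Size of the Chebyshev polynomials and of the coefficients -/

lemma abs_chebU_mul_sqrt_le (n : ℕ) {t : ℝ} (ht : |t| ≤ 1) : |chebU n t| * √(1 - t ^ 2) ≤ 1 := by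
  have h := Polynomial.Chebyshev.U_real_cos (θ := Real.arccos t) (n := n)
  rw [Real.cos_arccos (neg_le_of_abs_le ht) (le_of_abs_le ht), Real.sin_arccos] at h
  have h2 := congrArg abs h
  rw [abs_mul, abs_of_nonneg (Real.sqrt_nonneg _)] at h2
  rw [chebU, h2]
  exact Real.abs_sin_le_one _

lemma abs_chebU_one_le (n : ℕ) {t : ℝ} (ht : t ^ 2 = 1) : |chebU n t| ≤ n + 1 := by
  rcases sq_eq_sq_iff_eq_or_eq_neg.mp (ht.trans (one_pow 2).symm) with rfl | rfl
  · rw [chebU, Polynomial.Chebyshev.U_eval_one]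
    push_cast
    rw [abs_of_nonneg (by positivity)]
  · rw [chebU, Polynomial.Chebyshev.U_eval_neg_one, abs_mul]
    have : |((n : ℤ).negOnePow : ℝ)| = 1 := by
      rcases Int.units_eq_one_or (n : ℤ).negOnePow with h | h <;> rw [h] <;> simp
    rw [this]
    push_cast
    rw [abs_of_nonneg (by positivity), one_mul]

lemma card_sqrt_le (l : ℕ) (I : Finset ℤ) :
    ((I.filter fun a => a ^ 2 = (l : ℤ)).card : ℝ) ≤ if IsSquare l then 2 else 0 := by
  split_ifs with h
  · obtain ⟨r, rfl⟩ := h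
    have : (I.filter fun a => a ^ 2 = ((r * r : ℕ) : ℤ)) ⊆ {(r : ℤ), -(r : ℤ)} := by
      intro a ha
      rw [Finset.mem_filter] at ha
      have h2 : a ^ 2 = (r : ℤ) ^ 2 := by rw [ha.2]; push_cast; ring
      simpa using sq_eq_sq_iff_eq_or_eq_neg.mp h2
    exact_mod_cast (Finset.card_le_card this).trans Finset.card_le_two
  · rw [Nat.cast_nonpos, Finset.card_eq_zero, Finset.filter_eq_empty_iff]
    rintro a - ha
    refine h ⟨a.natAbs, ?_⟩
    zify
    rw [← sq, sq_abs, ha]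

/-- The sum of `|U_n|` over the four-square representations of `l`: a representation with first
coordinate `a` and `k = l - a² > 0` contributes at most `√(l / k)`, while the number of those is
about `√k`, so that all first coordinates contribute about `√l`, except for `a = ± √l`. -/
lemma exists_sum_abs_chebU_le {ε : ℝ} (hε : 0 < ε) :
    ∃ C : ℝ, 1 ≤ C ∧ ∀ n l : ℕ, l ≠ 0 →
      ∑ p ∈ fourSquares l, |chebU n (p.1 / √l)| ≤
        C * (l * (l : ℝ) ^ ε) + (n + 1) * if IsSquare l then 2 else 0 := by
  obtain ⟨C, hC, h⟩ := exists_card_threeSquares_le hε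
  refine ⟨3 * C, by linarith, fun n l hl => ?_⟩
  set I := Finset.Icc (-(Nat.sqrt l : ℤ)) (Nat.sqrt l) with hI
  have hl0 : (0 : ℝ) < l := by positivity
  have hmaps : ∀ p ∈ fourSquares l, p.1 ∈ I := by
    intro p hp
    rw [mem_fourSquares] at hp
    rw [hI, mem_Icc_natSqrt_iff]
    nlinarith [sq_nonneg p.2.1, sq_nonneg p.2.2.1, sq_nonneg p.2.2.2]
  have hfib : ∀ a ∈ I, (((fourSquares l).filter fun p => p.1 = a).card : ℝ) ≤
      (threeSquares (l - a ^ 2)).card := by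
    intro a _
    rw [Nat.cast_le]
    refine Finset.card_le_card_of_injOn (fun p => p.2) ?_ ?_
    · rintro ⟨a', b, c, d⟩ hp
      simp only [Finset.coe_filter, Set.mem_ofPred_eq, mem_fourSquares, Finset.mem_coe,
        mem_threeSquares] at hp ⊢
      rw [← hp.1, ← hp.2]; ring
    · rintro ⟨a', q⟩ hp ⟨a'', q'⟩ hp' heq
      simp only [Finset.coe_filter, Set.mem_ofPred_eq] at hp hp' heq
      rw [hp.2, hp'.2, heq]
  have hterm : ∀ a ∈ I, ((threeSquares (l - a ^ 2)).card : ℝ) * |chebU n (a / √l)| ≤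
      C * √l * (l : ℝ) ^ ε + if a ^ 2 = (l : ℤ) then (n + 1 : ℝ) else 0 := by
    intro a ha
    have hsq : ((a : ℝ) / √l) ^ 2 = a ^ 2 / l := by rw [div_pow, Real.sq_sqrt hl0.le]
    rw [hI, mem_Icc_natSqrt_iff] at ha
    split_ifs with hal
    · have h0 : (threeSquares (l - a ^ 2)).card ≤ 1 := by
        rw [hal, sub_self]; decide
      have h1 : |chebU n (a / √l)| ≤ n + 1 := by
        refine abs_chebU_one_le n ?_
        have : (a : ℝ) ^ 2 = l := by exact_mod_cast hal
        rw [hsq, this, div_self hl0.ne']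
      calc _ ≤ (1 : ℝ) * (n + 1) := by gcongr; exact_mod_cast h0
        _ ≤ _ := by
          have : 0 ≤ C * √l * (l : ℝ) ^ ε := by positivity
          linarith
    · obtain ⟨k, hk⟩ : ∃ k : ℕ, (l : ℤ) - a ^ 2 = k := ⟨(l - a ^ 2 : ℤ).toNat, by omega⟩
      have hk0 : k ≠ 0 := by rintro rfl; push_cast at hk; apply hal; linarith
      have hkl : k ≤ l := by
        have := sq_nonneg a
        have : (k : ℤ) ≤ l := by linarith
        exact_mod_cast this
      have hkr : (l : ℝ) - a ^ 2 = k := by exact_mod_cast hk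
      have hU := abs_chebU_mul_sqrt_le n (t := a / √l) (by
        rw [← sq_le_one_iff_abs_le_one, hsq, div_le_one hl0]
        exact_mod_cast ha)
      have h1 : 1 - ((a : ℝ) / √l) ^ 2 = k / l := by rw [hsq, ← hkr]; field_simp
      rw [h1, Real.sqrt_div (by positivity), ← mul_div_assoc, div_le_one (by positivity)] at hU
      rw [hk, add_zero]
      calc ((threeSquares k).card : ℝ) * |chebU n (a / √l)|
          ≤ (C * √k * (k : ℝ) ^ ε) * |chebU n (a / √l)| := by gcongr; exact h k hk0
        _ = C * (|chebU n (a / √l)| * √k) * (k : ℝ) ^ ε := by ring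
        _ ≤ C * √l * (l : ℝ) ^ ε := by gcongr
  calc ∑ p ∈ fourSquares l, |chebU n (p.1 / √l)|
      = ∑ a ∈ I, ∑ p ∈ (fourSquares l).filter (fun p => p.1 = a), |chebU n (p.1 / √l)| :=
        (Finset.sum_fiberwise_of_maps_to hmaps _).symm
    _ = ∑ a ∈ I, ((fourSquares l).filter fun p => p.1 = a).card * |chebU n (a / √l)| := by
        refine Finset.sum_congr rfl fun a _ => ?_
        rw [← nsmul_eq_mul, ← Finset.sum_const]
        refine Finset.sum_congr rfl fun p hp => ?_
        rw [(Finset.mem_filter.mp hp).2]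
    _ ≤ ∑ a ∈ I, (C * √l * (l : ℝ) ^ ε + if a ^ 2 = (l : ℤ) then (n + 1 : ℝ) else 0) := by
        refine Finset.sum_le_sum fun a ha => le_trans ?_ (hterm a ha)
        gcongr
        exact_mod_cast hfib a ha
    _ = I.card * (C * √l * (l : ℝ) ^ ε) +
          (n + 1) * (I.filter fun a => a ^ 2 = (l : ℤ)).card := by
        rw [Finset.sum_add_distrib, Finset.sum_const, nsmul_eq_mul, ← Finset.sum_filter,
          Finset.sum_const, nsmul_eq_mul, mul_comm ((n : ℝ) + 1)]
    _ ≤ 3 * √l * (C * √l * (l : ℝ) ^ ε) + (n + 1) * if IsSquare l then 2 else 0 := by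
        gcongr
        · exact card_Icc_natSqrt_le hl
        · exact card_sqrt_le l I
    _ = 3 * C * (√l * √l * (l : ℝ) ^ ε) + (n + 1) * if IsSquare l then 2 else 0 := by ring
    _ = _ := by rw [Real.mul_self_sqrt hl0.le]

/-! ### The zonal harmonic polynomials -/

/-- The polynomial `N ^ (n / 2) * U_n (s / (2 √N))` in `s` and `N`. With `s = λ + μ` and
`N = λ μ` it is the complete homogeneous polynomial `∑ λ ^ j μ ^ (n - j)`. -/
def zonal {R : Type*} [CommRing R] : ℕ → R → R → R
  | 0, _, _ => 1
  | 1, s, _ => s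
  | n + 2, s, N => s * zonal (n + 1) s N - N * zonal n s N

lemma ofReal_zonal (n : ℕ) (s N : ℝ) : ((zonal n s N : ℝ) : ℂ) = zonal n (s : ℂ) (N : ℂ) := by
  induction n using Nat.twoStepInduction with
  | zero => simp [zonal]
  | one => simp [zonal]
  | more n h1 h2 => simp [zonal, h1, h2]

lemma zonal_homogeneous {R : Type*} [CommRing R] (n : ℕ) (c s N : R) :
    zonal n (c * s) (c ^ 2 * N) = c ^ n * zonal n s N := by
  induction n using Nat.twoStepInduction with
  | zero => simp [zonal]
  | one => simp [zonal]
  | more n h1 h2 => simp only [zonal, h1, h2]; ring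

lemma zonal_zero {R : Type*} [CommRing R] {n : ℕ} (hn : n ≠ 0) : zonal n (0 : R) 0 = 0 := by
  simpa [hn] using zonal_homogeneous n (0 : R) 0 0

lemma pow_mul_chebU (n : ℕ) {r : ℝ} (hr : r ≠ 0) (s : ℝ) :
    r ^ n * chebU n (1 / (2 * r) * s) = zonal n s (r ^ 2) := by
  induction n using Nat.twoStepInduction with
  | zero => simp [zonal, chebU]
  | one =>
    simp only [zonal, chebU, Nat.cast_one, Polynomial.Chebyshev.U_one, Polynomial.eval_mul,
      Polynomial.eval_ofNat, Polynomial.eval_X]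
    field_simp
  | more n h1 h2 =>
    rw [zonal, ← h1, ← h2, chebU, chebU, chebU]
    have h3 : ((n + 2 : ℕ) : ℤ) = (n : ℤ) + 2 := by push_cast; ring
    have h4 : ((n + 1 : ℕ) : ℤ) = (n : ℤ) + 1 := by push_cast; ring
    rw [h3, h4, Polynomial.Chebyshev.U_add_two]
    simp only [Polynomial.eval_sub, Polynomial.eval_mul, Polynomial.eval_ofNat, Polynomial.eval_X]
    field_simp
    ring

lemma rpow_mul_chebU (n : ℕ) {N : ℝ} (hN : 0 < N) (s : ℝ) :
    N ^ ((n : ℝ) / 2) * chebU n (1 / (2 * √N) * s) = zonal n s N := by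
  have hr : N ^ ((n : ℝ) / 2) = √N ^ n := by
    rw [Real.sqrt_eq_rpow, ← Real.rpow_natCast, ← Real.rpow_mul hN.le]; congr 1; ring
  rw [hr, pow_mul_chebU n (Real.sqrt_pos.mpr hN).ne', Real.sq_sqrt hN.le]

lemma sum_range_pow_mul_pow_succ {R : Type*} [CommRing R] (x y : R) (n : ℕ) :
    ∑ q ∈ Finset.range (n + 1 + 1), x ^ (n + 1 - q) * y ^ q =
      x * ∑ q ∈ Finset.range (n + 1), x ^ (n - q) * y ^ q + y ^ (n + 1) := by
  rw [Finset.sum_range_succ, Nat.sub_self, pow_zero, one_mul, Finset.mul_sum]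
  congr 1
  refine Finset.sum_congr rfl fun q hq => ?_
  have hq' : q ≤ n := by simpa [Nat.lt_succ_iff] using hq
  rw [Nat.succ_sub hq', pow_succ]; ring

lemma sum_range_pow_mul_pow_succ' {R : Type*} [CommRing R] (x y : R) (n : ℕ) :
    ∑ q ∈ Finset.range (n + 1 + 1), x ^ (n + 1 - q) * y ^ q =
      x ^ (n + 1) + y * ∑ q ∈ Finset.range (n + 1), x ^ (n - q) * y ^ q := by
  rw [Finset.sum_range_succ', Nat.sub_zero, pow_zero, mul_one, Finset.mul_sum, add_comm]
  congr 1
  refine Finset.sum_congr rfl fun q _ => ?_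
  rw [Nat.add_sub_add_right, pow_succ y]; ring

section MacMahon

open Polynomial

/-- The sum of the diagonal coefficients of `(a + cX)^(n-q) (b + dX)^q`, which is the trace of
the `n`-th symmetric power of the matrix with rows `(a, b)` and `(c, d)`. -/
lemma sum_coeff_eq_zonal (n : ℕ) (a b c d : ℂ) :
    ∑ q ∈ Finset.range (n + 1), ((C a + C c * X) ^ (n - q) * (C b + C d * X) ^ q : ℂ[X]).coeff q =
      zonal n (a + d) (a * d - b * c) := by
  set A : ℂ[X] := C a + C c * X with hA
  set B : ℂ[X] := C b + C d * X with hB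
  set G : ℕ → ℂ[X] := fun n => ∑ q ∈ Finset.range (n + 1), (X * A) ^ (n - q) * B ^ q with hG
  have hcoeff : ∀ n, (G n).coeff n =
      ∑ q ∈ Finset.range (n + 1), (A ^ (n - q) * B ^ q : ℂ[X]).coeff q := by
    intro n
    simp only [hG, Polynomial.finsetSum_coeff]
    refine Finset.sum_congr rfl fun q hq => ?_
    have hq' : q ≤ n := by simpa [Nat.lt_succ_iff] using hq
    rw [mul_pow, mul_assoc, Polynomial.coeff_X_pow_mul', if_pos (Nat.sub_le n q),
      Nat.sub_sub_self hq']
  -- `G n` is the complete homogeneous polynomial of degree `n` in `X A` and `B`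
  have hrec1 : ∀ n, G (n + 1) = X * A * G n + B ^ (n + 1) :=
    sum_range_pow_mul_pow_succ _ _
  have hrec2 : ∀ n, G (n + 1) = (X * A) ^ (n + 1) + B * G n :=
    sum_range_pow_mul_pow_succ' _ _
  have hrec : ∀ n, G (n + 2) = (X * A + B) * G (n + 1) - X * A * B * G n := by
    intro n
    rw [hrec1 (n + 1)]
    linear_combination (-B) * hrec1 n
  have hBdeg : ∀ n, (B ^ (n + 1)).coeff (n + 2) = 0 := by
    intro n
    apply Polynomial.coeff_eq_zero_of_natDegree_lt
    have : B.natDegree ≤ 1 := by rw [hB]; compute_degree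
    calc (B ^ (n + 1)).natDegree ≤ (n + 1) * 1 := Polynomial.natDegree_pow_le_of_le _ this
      _ < n + 2 := by omega
  rw [← hcoeff]
  induction n using Nat.twoStepInduction with
  | zero => simp [hG, zonal]
  | one =>
    rw [hrec1 0]
    have : G 0 = 1 := by simp [hG]
    rw [this]
    simp [zonal, hA, hB, Polynomial.coeff_X, Polynomial.coeff_C]
  | more n h1 h2 =>
    have e1 : (G (n + 1)).coeff (n + 2) = a * (G n).coeff (n + 1) + c * (G n).coeff n := by
      rw [hrec1 n, coeff_add, hBdeg, add_zero]
      have : X * A * G n = X * (C a * G n) + X ^ 2 * (C c * G n) := by rw [hA]; ring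
      rw [this, coeff_add, coeff_X_mul, coeff_X_pow_mul, coeff_C_mul, coeff_C_mul]
    have e2 : (G (n + 1)).coeff n = b * (G n).coeff n + d * (X * G n).coeff n := by
      rw [hrec2 n, coeff_add, mul_pow, coeff_X_pow_mul', if_neg (by omega), zero_add]
      have : B * G n = C b * G n + C d * (X * G n) := by rw [hB]; ring
      rw [this, coeff_add, coeff_C_mul, coeff_C_mul]
    have e3 : G (n + 2) = X * (C (a + d) * G (n + 1)) + (C b * G (n + 1) +
        X ^ 2 * (C c * G (n + 1))) - (X * (C (a * b) * G n) + X ^ 2 * (C (a * d + b * c) * G n)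
          + X ^ 2 * (C (c * d) * (X * G n))) := by
      rw [hrec, hA, hB]; simp only [C_add, C_mul]; ring
    rw [e3]
    simp only [coeff_add, coeff_sub, coeff_X_pow_mul]
    rw [show n + 2 = (n + 1) + 1 from rfl]
    simp only [coeff_X_mul, coeff_C_mul]
    rw [show (n + 1) + 1 = n + 2 from rfl, e1, e2, h1, h2, zonal]
    ring

/-- A coefficient of a polynomial of degree at most `n` is a linear combination of its values at
`0, …, n`. -/
lemma exists_coeff_eq_sum_eval (n : ℕ) : ∃ w : ℕ → ℕ → ℂ, ∀ p : ℂ[X], p.natDegree ≤ n →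
    ∀ r, p.coeff r = ∑ k ∈ Finset.range (n + 1), w r k * p.eval (k : ℂ) := by
  refine ⟨fun r k => (Lagrange.basis (Finset.range (n + 1)) (fun k : ℕ => (k : ℂ)) k).coeff r,
    fun p hp r => ?_⟩
  have h := Lagrange.eq_interpolate (s := Finset.range (n + 1)) (v := fun k : ℕ => (k : ℂ))
    (f := p) (fun _ _ _ _ h => Nat.cast_injective h)
    (by rw [Finset.card_range]; exact Polynomial.degree_lt_iff_coeff_zero _ _ |>.mpr fun m hm =>
      Polynomial.coeff_eq_zero_of_natDegree_lt (by omega))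
  conv_lhs => rw [h, Lagrange.interpolate_apply, Polynomial.finsetSum_coeff]
  refine Finset.sum_congr rfl fun k _ => ?_
  rw [Polynomial.coeff_C_mul, mul_comm]

/-- The zonal polynomial is a linear combination of `n`-th powers of linear forms
`(1, k) M (1, j)ᵀ`, where `M` has rows `(a, b)` and `(c, d)`. These forms are isotropic for
`det M`. -/
lemma exists_zonal_eq_sum_pow (n : ℕ) : ∃ w : ℕ → ℕ → ℂ, ∀ a b c d : ℂ,
    zonal n (a + d) (a * d - b * c) = ∑ k ∈ Finset.range (n + 1), ∑ j ∈ Finset.range (n + 1),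
      w k j * (a + c * k + (b + d * k) * j) ^ n := by
  obtain ⟨w, hw⟩ := exists_coeff_eq_sum_eval n
  have hlin : ∀ x y : ℂ, (C x + C y * X : ℂ[X]).natDegree ≤ 1 := fun x y => by compute_degree
  have hpow : ∀ q ∈ Finset.range (n + 1), ∀ x y : ℂ, x ^ (n - q) * y ^ q =
      ∑ j ∈ Finset.range (n + 1), ((n.choose q : ℂ))⁻¹ * w q j * (x + y * j) ^ n := by
    intro q hq x y
    have hq' : q ≤ n := by simpa [Nat.lt_succ_iff] using hq
    have h1 := hw ((C x + C y * X) ^ n)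
      ((Polynomial.natDegree_pow_le_of_le n (hlin x y)).trans (by omega)) q
    have h2 : ((C x + C y * X : ℂ[X]) ^ n).coeff q = n.choose q * (x ^ (n - q) * y ^ q) := by
      rw [add_comm, add_pow, Polynomial.finsetSum_coeff]
      rw [Finset.sum_eq_single q]
      · have : (C y * X : ℂ[X]) ^ q * C x ^ (n - q) * (n.choose q : ℂ[X]) =
            C (n.choose q * (x ^ (n - q) * y ^ q)) * X ^ q := by
          simp only [C_mul, C_pow, map_natCast]; ring
        rw [this, coeff_C_mul_X_pow, if_pos rfl]
      · intro r _ hr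
        have : (C y * X : ℂ[X]) ^ r * C x ^ (n - r) * (n.choose r : ℂ[X]) =
            C (n.choose r * (x ^ (n - r) * y ^ r)) * X ^ r := by
          simp only [C_mul, C_pow, map_natCast]; ring
        rw [this, coeff_C_mul_X_pow, if_neg hr.symm]
      · intro h; exact absurd hq h
    have hc : (n.choose q : ℂ) ≠ 0 := by exact_mod_cast (Nat.choose_pos hq').ne'
    rw [h2] at h1
    simp only [mul_assoc, ← Finset.mul_sum]
    rw [eq_inv_mul_iff_mul_eq₀ hc, h1]
    simp
  refine ⟨fun k j => ∑ q ∈ Finset.range (n + 1), w q k * (((n.choose q : ℂ))⁻¹ * w q j),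
    fun a b c d => ?_⟩
  rw [← sum_coeff_eq_zonal]
  have hstep : ∀ q ∈ Finset.range (n + 1),
      ((C a + C c * X) ^ (n - q) * (C b + C d * X) ^ q : ℂ[X]).coeff q =
      ∑ k ∈ Finset.range (n + 1), ∑ j ∈ Finset.range (n + 1),
        w q k * (((n.choose q : ℂ))⁻¹ * w q j) * (a + c * k + (b + d * k) * j) ^ n := by
    intro q hq
    have hq' : q ≤ n := by simpa [Nat.lt_succ_iff] using hq
    rw [hw _ ?_ q]
    · refine Finset.sum_congr rfl fun k _ => ?_
      rw [Polynomial.eval_mul, Polynomial.eval_pow, Polynomial.eval_pow]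
      simp only [Polynomial.eval_add, Polynomial.eval_mul, Polynomial.eval_C, Polynomial.eval_X]
      rw [hpow q hq, Finset.mul_sum]
      refine Finset.sum_congr rfl fun j _ => by ring
    · refine Polynomial.natDegree_mul_le.trans ?_
      have h1 := Polynomial.natDegree_pow_le_of_le (n - q) (hlin a c)
      have h2 := Polynomial.natDegree_pow_le_of_le q (hlin b d)
      omega
  rw [Finset.sum_congr rfl hstep, Finset.sum_comm]
  refine Finset.sum_congr rfl fun k _ => ?_
  rw [Finset.sum_comm]
  refine Finset.sum_congr rfl fun j _ => ?_
  rw [Finset.sum_mul]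

end MacMahon

/-! ### Theta series with harmonic coefficients -/

/-- Four-dimensional vectors as nested pairs. -/
def finFourEquiv (α : Type*) : (Fin 4 → α) ≃ α × α × α × α where
  toFun m := (m 0, m 1, m 2, m 3)
  invFun p := ![p.1, p.2.1, p.2.2.1, p.2.2.2]
  left_inv m := by ext i; fin_cases i <;> rfl
  right_inv p := rfl

lemma hasSum_prod_four {f : Fin 4 → ℤ → ℂ} {s : Fin 4 → ℂ} (hf : ∀ i, HasSum (f i) (s i)) :
    HasSum (fun m : Fin 4 → ℤ => ∏ i, f i (m i)) (∏ i, s i) := by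
  have hn : ∀ i, Summable fun m => ‖f i m‖ := fun i => (hf i).summable.norm
  have h23 := (hn 2).mul_norm (hn 3)
  have h123 := (hn 1).mul_norm h23
  have h0123 := (hn 0).mul_norm h123
  have h := (hf 0).mul ((hf 1).mul ((hf 2).mul (hf 3) h23.of_norm) h123.of_norm) h0123.of_norm
  rw [← (finFourEquiv ℤ).symm.hasSum_iff]
  convert! h using 1
  · ext p
    simp only [Function.comp_apply, Fin.prod_univ_four, mul_assoc]
    rfl
  · simp [Fin.prod_univ_four, mul_assoc]

/-- The functional equation of the two-variable Jacobi theta function, for a shifted lattice. -/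
lemma hasSum_shifted_gaussian (h : ℝ) (t : ℂ) {τ : ℂ} (hτ : 0 < τ.im) :
    HasSum (fun m : ℤ => Complex.exp (2 * Real.pi * Complex.I * t * (m + h) +
        Real.pi * Complex.I * (m + h) ^ 2 * τ))
      (1 / (-Complex.I * τ) ^ (1 / 2 : ℂ) * Complex.exp (-Real.pi * Complex.I * t ^ 2 / τ) *
        jacobiTheta₂ (t / τ + h) (-1 / τ)) := by
  have hτ0 : τ ≠ 0 := by rintro rfl; simp at hτ
  have h1 := (hasSum_jacobiTheta₂_term (t + h * τ) hτ).mul_left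
    (Complex.exp (2 * Real.pi * Complex.I * t * h + Real.pi * Complex.I * h ^ 2 * τ))
  rw [jacobiTheta₂_functional_equation] at h1
  convert! h1 using 1
  · ext m
    rw [jacobiTheta₂_term, ← Complex.exp_add]
    congr 1; ring
  · have h2 : (t + h * τ) / τ = t / τ + h := by field_simp
    rw [h2]
    have h3 : Complex.exp (-Real.pi * Complex.I * t ^ 2 / τ) =
        Complex.exp (2 * Real.pi * Complex.I * t * h + Real.pi * Complex.I * h ^ 2 * τ) *
        Complex.exp (-Real.pi * Complex.I * (t + h * τ) ^ 2 / τ) := by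
      rw [← Complex.exp_add]
      congr 1; field_simp; ring
    rw [h3]; ring

lemma summable_gaussian_mul_exp (h : ℝ) {y : ℝ} (hy : 0 < y) (R : ℝ) :
    Summable fun m : ℤ => Real.exp (-Real.pi * y * (m + h) ^ 2 + R * |m + h|) := by
  have key : ∀ r : ℝ, Summable fun m : ℤ => Real.exp (-Real.pi * y * (m + h) ^ 2 + r * (m + h)) := by
    intro r
    have h1 := (hasSum_shifted_gaussian h (-Complex.I * r / (2 * Real.pi)) (τ := Complex.I * y)
      (by simpa using hy)).summable.norm
    refine h1.congr fun m => ?_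
    rw [Complex.norm_exp]
    congr 1
    have : (2 * Real.pi * Complex.I * (-Complex.I * r / (2 * Real.pi)) * (m + h) +
        Real.pi * Complex.I * (m + h) ^ 2 * (Complex.I * y) : ℂ) =
        ((-Real.pi * y * (m + h) ^ 2 + r * (m + h) : ℝ) : ℂ) := by
      have hπ : (Real.pi : ℂ) ≠ 0 := by exact_mod_cast Real.pi_ne_zero
      push_cast
      field_simp
      linear_combination (-(r : ℂ) * (m + h) + Real.pi * (m + h) ^ 2 * y) * Complex.I_sq
    rw [this, Complex.ofReal_re]
  refine Summable.of_nonneg_of_le (fun _ => (Real.exp_pos _).le) (fun m => ?_)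
    ((key R).add (key (-R)))
  rcases abs_cases ((m : ℝ) + h) with ⟨h1, -⟩ | ⟨h1, -⟩ <;> rw [h1]
  · linarith [Real.exp_pos (-Real.pi * y * (m + h) ^ 2 + -R * (m + h))]
  · rw [mul_neg, ← neg_mul]
    linarith [Real.exp_pos (-Real.pi * y * (m + h) ^ 2 + R * (m + h))]

lemma summable_gaussian_four_mul_exp (h : Fin 4 → ℝ) {y : ℝ} (hy : 0 < y) (R : ℝ) :
    Summable fun m : Fin 4 → ℤ =>
      Real.exp (-Real.pi * y * ∑ i, (m i + h i) ^ 2) * Real.exp (R * ∑ i, |m i + h i|) := by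
  have h1 : ∀ i, Summable fun m : ℤ =>
      ((Real.exp (-Real.pi * y * (m + h i) ^ 2 + R * |m + h i|) : ℝ) : ℂ) := fun i => by
    have := summable_gaussian_mul_exp (h i) hy R
    exact Complex.ofRealCLM.summable this
  have h2 := (hasSum_prod_four fun i => (h1 i).hasSum).summable
  rw [← Complex.summable_ofReal]
  refine h2.congr fun m => ?_
  rw [← Complex.ofReal_prod, ← Real.exp_add, ← Real.exp_sum]
  congr 2
  rw [Finset.mul_sum, Finset.mul_sum, ← Finset.sum_add_distrib]

lemma im_neg_one_div_pos {τ : ℂ} (hτ : 0 < τ.im) : 0 < (-1 / τ).im := by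
  have hτ0 : τ ≠ 0 := by rintro rfl; simp at hτ
  rw [neg_div, one_div, Complex.neg_im, Complex.inv_im, neg_div, neg_neg]
  exact div_pos hτ (Complex.normSq_pos.mpr hτ0)

section Taylor

variable {ι : Type*} {W x : ι → ℂ}

/-- The sum of a family of exponentials as a power series whose coefficients are the moments. -/
lemma hasSum_exp_series (hW : ∀ R : ℝ, Summable fun i => ‖W i‖ * Real.exp (R * ‖x i‖)) (t : ℂ) :
    HasSum (fun n : ℕ => t ^ n * ((∑' i, W i * x i ^ n) / n.factorial))
      (∑' i, W i * Complex.exp (t * x i)) := by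
  have hfib : ∀ i, HasSum (fun n : ℕ => W i * ((t * x i) ^ n / n.factorial))
      (W i * Complex.exp (t * x i)) := fun i => by
    have := NormedSpace.expSeries_div_hasSum_exp (t * x i)
    rw [← Complex.exp_eq_exp_ℂ] at this
    exact this.mul_left _
  have hsum : Summable fun p : ι × ℕ => W p.1 * ((t * x p.1) ^ p.2 / p.2.factorial) := by
    apply Summable.of_norm
    have hn : ∀ i, HasSum (fun n : ℕ => ‖W i * ((t * x i) ^ n / n.factorial)‖)
        (‖W i‖ * Real.exp (‖t‖ * ‖x i‖)) := fun i => by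
      have := NormedSpace.expSeries_div_hasSum_exp (‖t‖ * ‖x i‖)
      rw [← Real.exp_eq_exp_ℝ] at this
      convert! this.mul_left ‖W i‖ using 2 with n
      simp
    rw [summable_prod_of_nonneg fun _ => norm_nonneg _]
    exact ⟨fun i => (hn i).summable, (hW ‖t‖).congr fun i => ((hn i).tsum_eq).symm⟩
  have h1 := hsum.hasSum.prod_fiberwise hfib
  rw [h1.tsum_eq]
  have h2 := (Equiv.prodComm ℕ ι).hasSum_iff.mpr hsum.hasSum
  have h3 := h2.prod_fiberwise fun n => (h2.summable.prod_factor n).hasSum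
  convert! h3 using 2 with n
  simp only [Function.comp_apply, Equiv.prodComm_apply, Prod.swap_prod_mk]
  rw [← tsum_div_const, ← tsum_mul_left]
  refine tsum_congr fun i => ?_
  rw [mul_pow]; ring

lemma hasFPowerSeriesAt_tsum_exp
    (hW : ∀ R : ℝ, Summable fun i => ‖W i‖ * Real.exp (R * ‖x i‖)) :
    HasFPowerSeriesAt (fun t : ℂ => ∑' i, W i * Complex.exp (t * x i))
      (FormalMultilinearSeries.ofScalars ℂ
        fun n : ℕ => (∑' i, W i * x i ^ n) / (n.factorial : ℂ)) 0 := by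
  rw [hasFPowerSeriesAt_iff]
  refine Filter.Eventually.of_forall fun t => ?_
  simpa [FormalMultilinearSeries.coeff_ofScalars] using hasSum_exp_series hW t

/-- Two absolutely convergent families of exponentials with the same sum have the same moments:
these are the Taylor coefficients at `0`. -/
lemma tsum_mul_pow_eq_of_tsum_exp_eq {ι' : Type*} {V y : ι' → ℂ}
    (hW : ∀ R : ℝ, Summable fun i => ‖W i‖ * Real.exp (R * ‖x i‖))
    (hV : ∀ R : ℝ, Summable fun i => ‖V i‖ * Real.exp (R * ‖y i‖))
    (h : ∀ t : ℂ, ∑' i, W i * Complex.exp (t * x i) = ∑' i, V i * Complex.exp (t * y i)) (n : ℕ) :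
    ∑' i, W i * x i ^ n = ∑' i, V i * y i ^ n := by
  have h1 := hasFPowerSeriesAt_tsum_exp hW
  have h2 := hasFPowerSeriesAt_tsum_exp hV
  simp_rw [h] at h1
  have h3 := congrArg (fun p => p.coeff n) (h1.eq_formalMultilinearSeries h2)
  simp only [FormalMultilinearSeries.coeff_ofScalars] at h3
  exact (div_left_inj' (by exact_mod_cast n.factorial_ne_zero)).mp h3

lemma summable_mul_pow_of_exp
    (hW : ∀ R : ℝ, Summable fun i => ‖W i‖ * Real.exp (R * ‖x i‖)) (n : ℕ) :
    Summable fun i => W i * x i ^ n := by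
  apply Summable.of_norm_bounded ((hW 1).mul_left (n.factorial : ℝ))
  intro i
  rw [norm_mul, norm_pow, one_mul, mul_left_comm]
  gcongr
  have := Real.pow_div_factorial_le_exp ‖x i‖ (norm_nonneg _) n
  rwa [div_le_iff₀' (by positivity)] at this

end Taylor

section Isotropic

variable (h : Fin 4 → ℝ) (w : Fin 4 → ℂ) {τ : ℂ}

lemma norm_exp_mul_sum_sq (m : Fin 4 → ℤ) : ‖Complex.exp (Real.pi * Complex.I *
    (∑ i, (m i + h i : ℂ) ^ 2) * τ)‖ = Real.exp (-Real.pi * τ.im * ∑ i, (m i + h i) ^ 2) := by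
  rw [Complex.norm_exp]
  congr 1
  have : (Real.pi * Complex.I * (∑ i, (m i + h i : ℂ) ^ 2) * τ) =
      ((Real.pi * ∑ i, (m i + h i : ℝ) ^ 2 : ℝ) : ℂ) * (Complex.I * τ) := by
    push_cast; ring
  rw [this, Complex.re_ofReal_mul]
  simp; ring

lemma norm_sum_mul_le (u : Fin 4 → ℝ) : ‖∑ i, w i * u i‖ ≤ (∑ i, ‖w i‖) * ∑ i, |u i| := by
  calc ‖∑ i, w i * u i‖ ≤ ∑ i, ‖w i‖ * |u i| := by
        refine (norm_sum_le _ _).trans (Finset.sum_le_sum fun i _ => ?_)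
        simp
    _ ≤ ∑ i, (∑ j, ‖w j‖) * |u i| := by
        gcongr with i
        exact Finset.single_le_sum (f := fun j => ‖w j‖) (fun _ _ => norm_nonneg _)
          (Finset.mem_univ i)
    _ = _ := by rw [Finset.mul_sum]

lemma summable_theta_weight (hτ : 0 < τ.im) (c : ℂ) (R : ℝ) : Summable fun m : Fin 4 → ℤ =>
    ‖Complex.exp (Real.pi * Complex.I * (∑ i, (m i + h i : ℂ) ^ 2) * τ)‖ *
      Real.exp (R * ‖c * ∑ i, w i * (m i + h i : ℂ)‖) := by
  refine Summable.of_nonneg_of_le (fun _ => by positivity) (fun m => ?_)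
    (summable_gaussian_four_mul_exp h hτ (|R| * ‖c‖ * ∑ i, ‖w i‖))
  rw [norm_exp_mul_sum_sq]
  refine mul_le_mul_of_nonneg_left (Real.exp_le_exp.mpr ?_) (Real.exp_pos _).le
  have h1 := norm_sum_mul_le w (fun i => m i + h i)
  push_cast at h1
  rw [norm_mul]
  calc R * (‖c‖ * ‖∑ i, w i * (m i + h i : ℂ)‖)
      ≤ |R| * (‖c‖ * ((∑ i, ‖w i‖) * ∑ i, |(m i + h i : ℝ)|)) := by
        gcongr
        exact le_abs_self R
    _ = _ := by ring

/-- The transformation of the exponential generating series of powers of an isotropic linear form: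
the Gaussian factors of the four Jacobi theta functions cancel. -/
lemma tsum_exp_isotropic (hw : ∑ i, w i ^ 2 = 0) (hτ : 0 < τ.im) (t : ℂ) :
    ∑' m : Fin 4 → ℤ, Complex.exp (Real.pi * Complex.I * (∑ i, (m i + h i : ℂ) ^ 2) * τ) *
        Complex.exp (t * ∑ i, w i * (m i + h i : ℂ)) =
      ∑' m : Fin 4 → ℤ, (-1 / τ ^ 2 * Complex.exp (2 * Real.pi * Complex.I * ∑ i, (m i : ℂ) * h i) *
        Complex.exp (Real.pi * Complex.I * (∑ i, (m i : ℂ) ^ 2) * (-1 / τ))) *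
        Complex.exp (t * (τ⁻¹ * ∑ i, w i * m i)) := by
  have hτ0 : τ ≠ 0 := by rintro rfl; simp at hτ
  have hπ : (Real.pi : ℂ) ≠ 0 := by exact_mod_cast Real.pi_ne_zero
  have hτ' : 0 < (-1 / τ).im := im_neg_one_div_pos hτ
  set s : Fin 4 → ℂ := fun i => t * w i / (2 * Real.pi * Complex.I) with hs
  have hst : ∀ i, 2 * Real.pi * Complex.I * s i = t * w i := fun i => by
    simp only [hs]; field_simp
  have h1 := (hasSum_prod_four fun i => hasSum_shifted_gaussian (h i) (s i) hτ).tsum_eq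
  have h2 := (hasSum_prod_four fun i => hasSum_jacobiTheta₂_term (s i / τ + h i) hτ').tsum_eq
  have hκ : (1 / (-Complex.I * τ) ^ (1 / 2 : ℂ)) ^ 4 = -1 / τ ^ 2 := by
    rw [div_pow, one_pow, ← Complex.cpow_nat_mul]
    norm_num
    rw [mul_pow, Complex.I_sq]
    simp [neg_div]
  -- the only place where isotropy enters
  have hG : ∏ i, Complex.exp (-Real.pi * Complex.I * s i ^ 2 / τ) = 1 := by
    rw [← Complex.exp_sum, ← Finset.sum_div, ← Finset.mul_sum]
    have : ∑ i, s i ^ 2 = 0 := by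
      simp only [hs, div_pow, mul_pow]
      rw [← Finset.sum_div, ← Finset.mul_sum, hw]; simp
    rw [this]; simp
  calc _ = ∑' m : Fin 4 → ℤ, ∏ i, Complex.exp (2 * Real.pi * Complex.I * s i * (m i + h i) +
        Real.pi * Complex.I * (m i + h i) ^ 2 * τ) := by
        refine tsum_congr fun m => ?_
        rw [← Complex.exp_add, ← Complex.exp_sum]
        congr 1
        rw [Finset.sum_add_distrib, ← Finset.sum_mul, ← Finset.mul_sum, add_comm, Finset.mul_sum]
        congr 1
        refine Finset.sum_congr rfl fun i _ => ?_
        rw [hst]; ring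
    _ = -1 / τ ^ 2 * ∏ i, jacobiTheta₂ (s i / τ + h i) (-1 / τ) := by
        rw [h1, Finset.prod_mul_distrib, Finset.prod_mul_distrib, hG, Finset.prod_const,
          Finset.card_univ, Fintype.card_fin, hκ, mul_one]
    _ = _ := by
        rw [← h2, ← tsum_mul_left]
        refine tsum_congr fun m => ?_
        rw [mul_assoc, mul_assoc, ← Complex.exp_add, ← Complex.exp_add]
        simp only [jacobiTheta₂_term]
        rw [← Complex.exp_sum]
        congr 2
        rw [Finset.sum_add_distrib, ← Finset.sum_mul, ← Finset.mul_sum]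
        have : ∑ i, 2 * Real.pi * Complex.I * m i * (s i / τ + h i) =
            2 * Real.pi * Complex.I * ∑ i, (m i : ℂ) * h i + t * (τ⁻¹ * ∑ i, w i * m i) := by
          simp only [Finset.mul_sum]
          rw [← Finset.sum_add_distrib]
          refine Finset.sum_congr rfl fun i _ => ?_
          linear_combination (m i : ℂ) * τ⁻¹ * hst i
        rw [this]; ring

lemma norm_exp_pairing (m : Fin 4 → ℤ) :
    ‖Complex.exp (2 * Real.pi * Complex.I * ∑ i, (m i : ℂ) * h i)‖ = 1 := by
  have : (2 * Real.pi * Complex.I * ∑ i, (m i : ℂ) * h i) =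
      ((2 * Real.pi * ∑ i, (m i : ℝ) * h i : ℝ) : ℂ) * Complex.I := by push_cast; ring
  rw [this, Complex.norm_exp_ofReal_mul_I]

lemma summable_dual_pow (hτ : 0 < τ.im) (n : ℕ) : Summable fun m : Fin 4 → ℤ =>
    Complex.exp (2 * Real.pi * Complex.I * ∑ i, (m i : ℂ) * h i) *
      Complex.exp (Real.pi * Complex.I * (∑ i, (m i : ℂ) ^ 2) * τ) * (∑ i, w i * m i) ^ n := by
  apply Summable.of_norm
  refine (summable_mul_pow_of_exp (summable_theta_weight 0 w hτ 1) n).norm.congr fun m => ?_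
  simp only [norm_mul, norm_exp_pairing]
  simp

/-- The transformation formula with a power of an isotropic linear form: the `n`-th moments of the
two sides of `tsum_exp_isotropic`. -/
lemma tsum_pow_isotropic (hw : ∑ i, w i ^ 2 = 0) (hτ : 0 < τ.im) (n : ℕ) :
    ∑' m : Fin 4 → ℤ, Complex.exp (Real.pi * Complex.I * (∑ i, (m i + h i : ℂ) ^ 2) * τ) *
        (∑ i, w i * (m i + h i : ℂ)) ^ n =
      -1 / τ ^ 2 * τ⁻¹ ^ n * ∑' m : Fin 4 → ℤ,
        Complex.exp (2 * Real.pi * Complex.I * ∑ i, (m i : ℂ) * h i) *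
        Complex.exp (Real.pi * Complex.I * (∑ i, (m i : ℂ) ^ 2) * (-1 / τ)) *
        (∑ i, w i * m i) ^ n := by
  have key := tsum_mul_pow_eq_of_tsum_exp_eq (fun R => ?_) (fun R => ?_)
    (tsum_exp_isotropic h w hw hτ) n
  · rw [key, ← tsum_mul_left]
    exact tsum_congr fun m => by ring
  · simpa using summable_theta_weight h w hτ 1 R
  · have h1 := (summable_theta_weight 0 w (im_neg_one_div_pos hτ) τ⁻¹ R).mul_left ‖-1 / τ ^ 2‖
    refine h1.congr fun m => ?_
    rw [norm_mul (_ * _), norm_mul (-1 / τ ^ 2), norm_exp_pairing]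
    simp [mul_assoc]

end Isotropic

section ZonalTheta

/-- The zonal polynomial as a linear combination of powers of isotropic linear forms. -/
lemma exists_zonal_eq_sum_isotropic (n : ℕ) : ∃ (c : ℕ → ℕ → ℂ) (w : ℕ → ℕ → Fin 4 → ℂ),
    (∀ k j, ∑ i, w k j i ^ 2 = 0) ∧ ∀ u : Fin 4 → ℂ, zonal n (2 * u 0) (∑ i, u i ^ 2) =
      ∑ k ∈ Finset.range (n + 1), ∑ j ∈ Finset.range (n + 1), c k j * (∑ i, w k j i * u i) ^ n := by
  obtain ⟨c, hc⟩ := exists_zonal_eq_sum_pow n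
  refine ⟨c, fun k j => ![1 + k * j, Complex.I * (1 - k * j), j - k, Complex.I * (j + k)],
    fun k j => ?_, fun u => ?_⟩
  · simp only [Fin.sum_univ_four, Matrix.cons_val, mul_pow, Complex.I_sq]
    ring
  · -- the matrix of the quaternion `u 0 + u 1 i + u 2 j + u 3 k`
    have h := hc (u 0 + Complex.I * u 1) (u 2 + Complex.I * u 3) (-u 2 + Complex.I * u 3)
      (u 0 - Complex.I * u 1)
    have h1 : u 0 + Complex.I * u 1 + (u 0 - Complex.I * u 1) = 2 * u 0 := by ring
    have h2 : (u 0 + Complex.I * u 1) * (u 0 - Complex.I * u 1) -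
        (u 2 + Complex.I * u 3) * (-u 2 + Complex.I * u 3) = ∑ i, u i ^ 2 := by
      rw [Fin.sum_univ_four]
      linear_combination (-(u 1) ^ 2 - (u 3) ^ 2) * Complex.I_sq
    rw [h1, h2] at h
    rw [h]
    refine Finset.sum_congr rfl fun k _ => Finset.sum_congr rfl fun j _ => ?_
    congr 2
    simp only [Fin.sum_univ_four, Matrix.cons_val]
    ring

lemma mul_sum_sum_mul (s t : Finset ℕ) (a : ℂ) (f g : ℕ → ℕ → ℂ) :
    a * ∑ k ∈ s, ∑ j ∈ t, f k j * g k j = ∑ k ∈ s, ∑ j ∈ t, f k j * (a * g k j) := by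
  rw [Finset.mul_sum]
  refine Finset.sum_congr rfl fun k _ => ?_
  rw [Finset.mul_sum]
  exact Finset.sum_congr rfl fun j _ => by ring

variable (n : ℕ) (h : Fin 4 → ℝ) {τ : ℂ}

lemma summable_dual_zonal (hτ : 0 < τ.im) : Summable fun m : Fin 4 → ℤ =>
    Complex.exp (2 * Real.pi * Complex.I * ∑ i, (m i : ℂ) * h i) *
      Complex.exp (Real.pi * Complex.I * (∑ i, (m i : ℂ) ^ 2) * τ) *
      zonal n (2 * m 0 : ℂ) (∑ i, (m i : ℂ) ^ 2) := by
  obtain ⟨c, w, -, hz⟩ := exists_zonal_eq_sum_isotropic n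
  have hs : Summable fun m : Fin 4 → ℤ => ∑ k ∈ Finset.range (n + 1), ∑ j ∈ Finset.range (n + 1),
      c k j * (Complex.exp (2 * Real.pi * Complex.I * ∑ i, (m i : ℂ) * h i) *
          Complex.exp (Real.pi * Complex.I * (∑ i, (m i : ℂ) ^ 2) * τ) *
          (∑ i, w k j i * m i) ^ n) :=
    summable_sum fun k _ => summable_sum fun j _ => (summable_dual_pow h (w k j) hτ n).mul_left _
  refine hs.congr fun m => ?_
  rw [hz fun i => (m i : ℂ), mul_sum_sum_mul]

/-- The transformation formula for the theta series of a shifted lattice with zonal harmonic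
coefficients, by linearity from powers of isotropic linear forms. -/
lemma tsum_zonal (hτ : 0 < τ.im) :
    ∑' m : Fin 4 → ℤ, Complex.exp (Real.pi * Complex.I * (∑ i, (m i + h i : ℂ) ^ 2) * τ) *
        zonal n (2 * (m 0 + h 0) : ℂ) (∑ i, (m i + h i : ℂ) ^ 2) =
      -1 / τ ^ 2 * τ⁻¹ ^ n * ∑' m : Fin 4 → ℤ,
        Complex.exp (2 * Real.pi * Complex.I * ∑ i, (m i : ℂ) * h i) *
        Complex.exp (Real.pi * Complex.I * (∑ i, (m i : ℂ) ^ 2) * (-1 / τ)) *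
        zonal n (2 * m 0 : ℂ) (∑ i, (m i : ℂ) ^ 2) := by
  obtain ⟨c, w, hw, hz⟩ := exists_zonal_eq_sum_isotropic n
  have e1 : ∀ m : Fin 4 → ℤ,
      Complex.exp (Real.pi * Complex.I * (∑ i, (m i + h i : ℂ) ^ 2) * τ) *
        zonal n (2 * (m 0 + h 0) : ℂ) (∑ i, (m i + h i : ℂ) ^ 2) =
      ∑ k ∈ Finset.range (n + 1), ∑ j ∈ Finset.range (n + 1), c k j *
        (Complex.exp (Real.pi * Complex.I * (∑ i, (m i + h i : ℂ) ^ 2) * τ) *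
          (∑ i, w k j i * (m i + h i : ℂ)) ^ n) := fun m => by
    rw [hz fun i => (m i + h i : ℂ), mul_sum_sum_mul]
  have e2 : ∀ m : Fin 4 → ℤ,
      Complex.exp (2 * Real.pi * Complex.I * ∑ i, (m i : ℂ) * h i) *
        Complex.exp (Real.pi * Complex.I * (∑ i, (m i : ℂ) ^ 2) * (-1 / τ)) *
        zonal n (2 * m 0 : ℂ) (∑ i, (m i : ℂ) ^ 2) =
      ∑ k ∈ Finset.range (n + 1), ∑ j ∈ Finset.range (n + 1), c k j *
        (Complex.exp (2 * Real.pi * Complex.I * ∑ i, (m i : ℂ) * h i) *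
          Complex.exp (Real.pi * Complex.I * (∑ i, (m i : ℂ) ^ 2) * (-1 / τ)) *
          (∑ i, w k j i * m i) ^ n) := fun m => by
    rw [hz fun i => (m i : ℂ), mul_sum_sum_mul]
  have hs1 : ∀ k j, Summable fun m : Fin 4 → ℤ => c k j *
      (Complex.exp (Real.pi * Complex.I * (∑ i, (m i + h i : ℂ) ^ 2) * τ) *
          (∑ i, w k j i * (m i + h i : ℂ)) ^ n) := fun k j => by
    refine Summable.mul_left _ (summable_mul_pow_of_exp (fun R => ?_) n)
    simpa using summable_theta_weight h (w k j) hτ 1 R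
  have hs2 : ∀ k j, Summable fun m : Fin 4 → ℤ => c k j *
      (Complex.exp (2 * Real.pi * Complex.I * ∑ i, (m i : ℂ) * h i) *
          Complex.exp (Real.pi * Complex.I * (∑ i, (m i : ℂ) ^ 2) * (-1 / τ)) *
          (∑ i, w k j i * m i) ^ n) := fun k j =>
    Summable.mul_left _ (summable_dual_pow h (w k j) (im_neg_one_div_pos hτ) n)
  simp_rw [e1, e2]
  rw [Summable.tsum_finsetSum fun k _ => summable_sum fun j _ => hs1 k j,
    Summable.tsum_finsetSum fun k _ => summable_sum fun j _ => hs2 k j, Finset.mul_sum]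
  refine Finset.sum_congr rfl fun k _ => ?_
  rw [Summable.tsum_finsetSum fun j _ => hs1 k j,
    Summable.tsum_finsetSum fun j _ => hs2 k j, Finset.mul_sum]
  refine Finset.sum_congr rfl fun j _ => ?_
  rw [tsum_mul_left, tsum_mul_left, tsum_pow_isotropic h (w k j) (hw k j) hτ n]
  ring

end ZonalTheta

/-! ### Theta series with congruence weights and the action of the modular group -/

/-- The theta series `∑ φ(m mod 2) P(m) e(|m|² z / 4)` over `m ∈ ℤ⁴`, where `P` is the zonal
harmonic polynomial of degree `n` and `φ` a function on `(ℤ/2)⁴`. -/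
noncomputable def thetaMod (n : ℕ) (φ : (Fin 4 → ZMod 2) → ℂ) (z : UpperHalfPlane) : ℂ :=
  ∑' m : Fin 4 → ℤ, φ (fun i => (m i : ZMod 2)) *
    (Complex.exp (Real.pi * Complex.I * (∑ i, (m i : ℂ) ^ 2) * (z / 2)) *
      zonal n (2 * m 0 : ℂ) (∑ i, (m i : ℂ) ^ 2))

lemma im_half_pos (z : UpperHalfPlane) : 0 < ((z : ℂ) / 2).im := by
  rw [Complex.div_ofNat_im]
  exact div_pos z.im_pos two_pos

lemma summable_exp_zonal (n : ℕ) {τ : ℂ} (hτ : 0 < τ.im) : Summable fun m : Fin 4 → ℤ =>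
    Complex.exp (Real.pi * Complex.I * (∑ i, (m i : ℂ) ^ 2) * τ) *
      zonal n (2 * m 0 : ℂ) (∑ i, (m i : ℂ) ^ 2) := by
  simpa using summable_dual_zonal n 0 hτ

lemma summable_thetaMod (n : ℕ) (φ : (Fin 4 → ZMod 2) → ℂ) (z : UpperHalfPlane) :
    Summable fun m : Fin 4 → ℤ => φ (fun i => (m i : ZMod 2)) *
    (Complex.exp (Real.pi * Complex.I * (∑ i, (m i : ℂ) ^ 2) * (z / 2)) *
      zonal n (2 * m 0 : ℂ) (∑ i, (m i : ℂ) ^ 2)) := by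
  refine Summable.of_norm_bounded
    ((summable_exp_zonal n (im_half_pos z)).norm.mul_left (∑ r, ‖φ r‖)) fun m => ?_
  rw [norm_mul]
  gcongr
  exact Finset.single_le_sum (f := fun r => ‖φ r‖) (fun _ _ => norm_nonneg _) (Finset.mem_univ _)

lemma intCast_eq_val_add (a : ℤ) : ∃ k : ℤ, a = ((a : ZMod 2).val : ℤ) + 2 * k := by
  have h : ((a - ((a : ZMod 2).val : ℤ) : ℤ) : ZMod 2) = 0 := by
    push_cast
    rw [ZMod.natCast_zmod_val, sub_self]
  obtain ⟨k, hk⟩ := (ZMod.intCast_zmod_eq_zero_iff_dvd _ 2).mp h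
  exact ⟨k, by push_cast at hk; linarith⟩

/-- A sum over a residue class modulo `2`. -/
lemma tsum_residue (g : Fin 4 → ZMod 2) (X : (Fin 4 → ℤ) → ℂ) :
    ∑' m : Fin 4 → ℤ, (if (fun i => (m i : ZMod 2)) = g then X m else 0) =
      ∑' k : Fin 4 → ℤ, X fun i => 2 * k i + ((g i).val : ℤ) := by
  have hinj : Function.Injective fun (k : Fin 4 → ℤ) (i : Fin 4) => 2 * k i + ((g i).val : ℤ) := by
    intro k k' h
    ext i
    have := congrFun h i
    simp only at this
    omega
  have h2 : (2 : ZMod 2) = 0 := rfl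
  rw [← hinj.tsum_eq (f := fun m : Fin 4 → ℤ => if (fun i => (m i : ZMod 2)) = g then X m else 0)]
  · refine tsum_congr fun k => ?_
    rw [if_pos]
    ext i
    push_cast
    rw [h2, zero_mul, zero_add, ZMod.natCast_zmod_val]
  · intro m hm
    have hg : (fun i => (m i : ZMod 2)) = g := by
      by_contra h
      exact hm (if_neg h)
    choose k hk using fun i => intCast_eq_val_add (m i)
    refine ⟨k, ?_⟩
    ext i
    simp only
    rw [← hg, add_comm]
    exact (hk i).symm

lemma exp_pi_I_congr {a b : ℤ} (h : ∃ k : ℤ, a = b + 2 * k) :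
    Complex.exp (Real.pi * Complex.I * a) = Complex.exp (Real.pi * Complex.I * b) := by
  obtain ⟨k, rfl⟩ := h
  rw [Complex.exp_eq_exp_iff_exists_int]
  exact ⟨k, by push_cast; ring⟩

/-- As `m²` modulo `4` depends only on `m` modulo `2`, so does the phase picked up by a
translation. -/
lemma exp_half_sum_sq (j : ℤ) (m : Fin 4 → ℤ) :
    Complex.exp (Real.pi * Complex.I * (∑ i, (m i : ℂ) ^ 2) * (j / 2)) =
      Complex.exp (Real.pi * Complex.I * (∑ i, ((m i : ZMod 2).val : ℂ) ^ 2) * (j / 2)) := by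
  choose k hk using fun i => intCast_eq_val_add (m i)
  rw [Complex.exp_eq_exp_iff_exists_int]
  refine ⟨j * ∑ i, (((m i : ZMod 2).val : ℤ) * k i + k i ^ 2), ?_⟩
  have : ∀ i, (m i : ℂ) ^ 2 = ((m i : ZMod 2).val : ℂ) ^ 2 +
      4 * ((((m i : ZMod 2).val : ℤ) * k i + k i ^ 2 : ℤ) : ℂ) := fun i => by
    have h1 : (m i : ℂ) = ((m i : ZMod 2).val : ℂ) + 2 * k i := by exact_mod_cast hk i
    rw [h1]; push_cast; ring
  simp_rw [this]
  rw [Finset.sum_add_distrib, ← Finset.mul_sum, Int.cast_mul, Int.cast_sum]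
  ring

lemma exists_thetaMod_T_zpow (j : ℤ) (φ : (Fin 4 → ZMod 2) → ℂ) :
    ∃ φ' : (Fin 4 → ZMod 2) → ℂ, ∀ (n : ℕ) (z : UpperHalfPlane),
      thetaMod n φ (ModularGroup.T ^ j • z) = thetaMod n φ' z := by
  refine ⟨fun r => φ r * Complex.exp (Real.pi * Complex.I * (∑ i, ((r i).val : ℂ) ^ 2) * (j / 2)),
    fun n z => tsum_congr fun m => ?_⟩
  beta_reduce
  rw [ModularGroup.coe_T_zpow_smul_eq, ← exp_half_sum_sq, add_div, mul_add, Complex.exp_add]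
  ring

/-- The discrete Fourier transform on `(ℤ/2)⁴`. -/
noncomputable def fourierMod (φ : (Fin 4 → ZMod 2) → ℂ) (r : Fin 4 → ZMod 2) : ℂ :=
  ∑ g, φ g * Complex.exp (Real.pi * Complex.I * ∑ i, ((r i).val : ℂ) * (g i).val)

lemma exp_pairing_eq (m : Fin 4 → ℤ) (g : Fin 4 → ZMod 2) :
    Complex.exp (2 * Real.pi * Complex.I * ∑ i, (m i : ℂ) * (((g i).val / 2 : ℝ) : ℂ)) =
      Complex.exp (Real.pi * Complex.I * ∑ i, ((m i : ZMod 2).val : ℂ) * (g i).val) := by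
  choose k hk using fun i => intCast_eq_val_add (m i)
  have h1 : (2 * Real.pi * Complex.I * ∑ i, (m i : ℂ) * (((g i).val / 2 : ℝ) : ℂ)) =
      Real.pi * Complex.I * ((∑ i, m i * ((g i).val : ℤ) : ℤ) : ℂ) := by
    push_cast
    simp only [Finset.mul_sum]
    exact Finset.sum_congr rfl fun i _ => by ring
  have h2 : (∑ i, ((m i : ZMod 2).val : ℂ) * (g i).val) =
      ((∑ i, ((m i : ZMod 2).val : ℤ) * ((g i).val : ℤ) : ℤ) : ℂ) := by push_cast; rfl
  rw [h1, h2]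
  refine exp_pi_I_congr ⟨∑ i, k i * ((g i).val : ℤ), ?_⟩
  rw [Finset.mul_sum, ← Finset.sum_add_distrib]
  refine Finset.sum_congr rfl fun i _ => ?_
  linear_combination ((g i).val : ℤ) * hk i

/-- The inversion formula for the theta series of a single residue class modulo `2`. -/
lemma tsum_residue_S_smul (n : ℕ) (g : Fin 4 → ZMod 2) (z : UpperHalfPlane) :
    ∑' k : Fin 4 → ℤ, (fun m : Fin 4 → ℤ =>
        Complex.exp (Real.pi * Complex.I * (∑ i, (m i : ℂ) ^ 2) *
          ((ModularGroup.S • z : UpperHalfPlane) / 2)) *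
        zonal n (2 * m 0 : ℂ) (∑ i, (m i : ℂ) ^ 2)) (fun i => 2 * k i + ((g i).val : ℤ)) =
      -(z : ℂ) ^ 2 / 4 * (-z) ^ n * ∑' m : Fin 4 → ℤ,
        Complex.exp (Real.pi * Complex.I * ∑ i, ((m i : ZMod 2).val : ℂ) * (g i).val) *
        (Complex.exp (Real.pi * Complex.I * (∑ i, (m i : ℂ) ^ 2) * (z / 2)) *
          zonal n (2 * m 0 : ℂ) (∑ i, (m i : ℂ) ^ 2)) := by
  have hz0 : (z : ℂ) ≠ 0 := z.ne_zero
  have hτ : 0 < (-2 / (z : ℂ)).im := by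
    have := im_neg_one_div_pos (im_half_pos z)
    rwa [div_div_eq_mul_div, neg_one_mul] at this
  have key := tsum_zonal n (fun i => (g i).val / 2) hτ
  have e1 : -1 / (-2 / (z : ℂ)) = z / 2 := by field_simp
  rw [e1] at key
  calc _ = 2 ^ n * ∑' m : Fin 4 → ℤ, Complex.exp (Real.pi * Complex.I *
          (∑ i, (m i + (((g i).val / 2 : ℝ) : ℂ)) ^ 2) * (-2 / z)) *
        zonal n (2 * (m 0 + (((g 0).val / 2 : ℝ) : ℂ)))
          (∑ i, (m i + (((g i).val / 2 : ℝ) : ℂ)) ^ 2) := by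
        rw [← tsum_mul_left]
        refine tsum_congr fun k => ?_
        have e2 : ∀ i, ((2 * k i + ((g i).val : ℤ) : ℤ) : ℂ) =
            2 * (k i + (((g i).val / 2 : ℝ) : ℂ)) := fun i => by push_cast; ring
        simp only [e2, mul_pow]
        rw [← Finset.mul_sum, zonal_homogeneous n (2 : ℂ)]
        rw [UpperHalfPlane.modular_S_smul]
        have e3 : ∀ s : ℂ, Real.pi * Complex.I * (2 ^ 2 * s) * ((-(z : ℂ))⁻¹ / 2) =
            Real.pi * Complex.I * s * (-2 / z) := fun s => by field_simp
        simp only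
        rw [e3]
        ring
    _ = _ := by
        rw [key, ← mul_assoc]
        congr 1
        · have : (-2 / (z : ℂ))⁻¹ = -z / 2 := by field_simp
          rw [this, div_pow, div_pow]
          field_simp
          ring
        · refine tsum_congr fun m => ?_
          rw [exp_pairing_eq, mul_assoc]

/-- The inversion formula for theta series with congruence weights. -/
lemma thetaMod_S_smul (n : ℕ) (φ : (Fin 4 → ZMod 2) → ℂ) (z : UpperHalfPlane) :
    thetaMod n φ (ModularGroup.S • z) =
      -(z : ℂ) ^ 2 / 4 * (-z) ^ n * thetaMod n (fourierMod φ) z := by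
  set X : (Fin 4 → ℤ) → ℂ := fun m =>
    Complex.exp (Real.pi * Complex.I * (∑ i, (m i : ℂ) ^ 2) *
      ((ModularGroup.S • z : UpperHalfPlane) / 2)) *
      zonal n (2 * m 0 : ℂ) (∑ i, (m i : ℂ) ^ 2) with hX
  set Y : (Fin 4 → ℤ) → ℂ := fun m =>
    Complex.exp (Real.pi * Complex.I * (∑ i, (m i : ℂ) ^ 2) * (z / 2)) *
      zonal n (2 * m 0 : ℂ) (∑ i, (m i : ℂ) ^ 2) with hY
  have hsX : ∀ g ∈ Finset.univ, Summable fun m : Fin 4 → ℤ =>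
      φ g * if (fun i => (m i : ZMod 2)) = g then X m else 0 := fun g _ => by
    refine Summable.mul_left _ ((summable_thetaMod n (fun r => if r = g then 1 else 0)
      (ModularGroup.S • z)).congr fun m => ?_)
    simp only [ite_mul, one_mul, zero_mul, hX]
  have hsY : ∀ g ∈ Finset.univ, Summable fun m : Fin 4 → ℤ => φ g *
      (Complex.exp (Real.pi * Complex.I * ∑ i, ((m i : ZMod 2).val : ℂ) * (g i).val) * Y m) :=
    fun g _ => (summable_thetaMod n (fun r =>
      Complex.exp (Real.pi * Complex.I * ∑ i, ((r i).val : ℂ) * (g i).val)) z).mul_left _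
  calc thetaMod n φ (ModularGroup.S • z)
      = ∑' m, ∑ g, φ g * (if (fun i => (m i : ZMod 2)) = g then X m else 0) := by
        refine tsum_congr fun m => ?_
        simp [hX]
    _ = ∑ g, φ g * ∑' k : Fin 4 → ℤ, X fun i => 2 * k i + ((g i).val : ℤ) := by
        rw [Summable.tsum_finsetSum hsX]
        refine Finset.sum_congr rfl fun g _ => ?_
        rw [tsum_mul_left, tsum_residue]
    _ = -(z : ℂ) ^ 2 / 4 * (-z) ^ n * ∑ g, ∑' m : Fin 4 → ℤ, φ g *
          (Complex.exp (Real.pi * Complex.I * ∑ i, ((m i : ZMod 2).val : ℂ) * (g i).val) * Y m) := by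
        rw [Finset.mul_sum]
        refine Finset.sum_congr rfl fun g _ => ?_
        rw [tsum_mul_left, tsum_residue_S_smul]
        ring
    _ = _ := by
        rw [← Summable.tsum_finsetSum hsY]
        congr 1
        refine tsum_congr fun m => ?_
        rw [fourierMod, Finset.sum_mul]
        exact Finset.sum_congr rfl fun g _ => by ring

lemma thetaMod_const_mul (n : ℕ) (c : ℂ) (φ : (Fin 4 → ZMod 2) → ℂ) (z : UpperHalfPlane) :
    thetaMod n (fun r => c * φ r) z = c * thetaMod n φ z := by
  rw [thetaMod, thetaMod, ← tsum_mul_left]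
  exact tsum_congr fun m => by ring

lemma exists_thetaMod_S (φ : (Fin 4 → ZMod 2) → ℂ) :
    ∃ φ' : (Fin 4 → ZMod 2) → ℂ, ∀ (n : ℕ) (z : UpperHalfPlane),
      ‖thetaMod n φ (ModularGroup.S • z)‖ ^ 2 * (ModularGroup.S • z).im ^ (n + 2) =
        ‖thetaMod n φ' z‖ ^ 2 * z.im ^ (n + 2) := by
  refine ⟨fun r => 1 / 4 * fourierMod φ r, fun n z => ?_⟩
  have hz0 : ‖(z : ℂ)‖ ≠ 0 := norm_ne_zero_iff.mpr z.ne_zero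
  have him : (ModularGroup.S • z).im = z.im / ‖(z : ℂ)‖ ^ 2 := by
    rw [UpperHalfPlane.modular_S_smul, UpperHalfPlane.mk_im, Complex.inv_im,
      Complex.normSq_eq_norm_sq, norm_neg, Complex.neg_im, neg_neg, UpperHalfPlane.coe_im]
  rw [thetaMod_S_smul, thetaMod_const_mul, him]
  simp only [norm_mul, norm_div, norm_neg, norm_pow, Complex.norm_ofNat, norm_one, div_pow]
  field_simp
  ring

/-- Up to the automorphy factor the modular group permutes the theta series with congruence
weights, through an action on the weights which does not depend on the degree `n`. -/
theorem exists_thetaMod_smul (γ : SL(2, ℤ)) (φ : (Fin 4 → ZMod 2) → ℂ) :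
    ∃ φ' : (Fin 4 → ZMod 2) → ℂ, ∀ (n : ℕ) (z : UpperHalfPlane),
      ‖thetaMod n φ (γ • z)‖ ^ 2 * (γ • z).im ^ (n + 2) =
        ‖thetaMod n φ' z‖ ^ 2 * z.im ^ (n + 2) := by
  have hT : ∀ (j : ℤ) (φ : (Fin 4 → ZMod 2) → ℂ), ∃ φ' : (Fin 4 → ZMod 2) → ℂ,
      ∀ (n : ℕ) (z : UpperHalfPlane),
      ‖thetaMod n φ (ModularGroup.T ^ j • z)‖ ^ 2 * (ModularGroup.T ^ j • z).im ^ (n + 2) =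
        ‖thetaMod n φ' z‖ ^ 2 * z.im ^ (n + 2) := by
    intro j φ
    obtain ⟨φ', h⟩ := exists_thetaMod_T_zpow j φ
    exact ⟨φ', fun n z => by rw [h, ModularGroup.im_T_zpow_smul]⟩
  have hγ : γ ∈ Subgroup.closure {ModularGroup.S, ModularGroup.T} := by
    rw [SpecialLinearGroup.SL2Z_generators]; exact Subgroup.mem_top γ
  induction hγ using Subgroup.closure_induction'' generalizing φ with
  | mem x hx =>
    rcases hx with rfl | rfl
    · exact exists_thetaMod_S φ
    · simpa using hT 1 φ
  | inv_mem x hx =>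
    rcases hx with rfl | rfl
    · obtain ⟨φ', h⟩ := exists_thetaMod_S φ
      refine ⟨φ', fun n z => ?_⟩
      rw [ModularGroup.S_inv, ModularGroup.SL_neg_smul]
      exact h n z
    · simpa using hT (-1) φ
  | one => exact ⟨φ, fun n z => by rw [one_smul]⟩
  | mul x y _ _ hx hy =>
    obtain ⟨φ₁, h₁⟩ := hx φ
    obtain ⟨φ₂, h₂⟩ := hy φ₁
    exact ⟨φ₂, fun n z => by rw [mul_smul, h₁, h₂]⟩

lemma redNr_intQuat (m : Quaternion ℤ) :
    redNr (intQuat m) = (m.re : ℝ) ^ 2 + (m.imI : ℝ) ^ 2 + (m.imJ : ℝ) ^ 2 + (m.imK : ℝ) ^ 2 := by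
  rw [redNr, Quaternion.self_mul_star, Quaternion.re_coe, Quaternion.normSq_def']
  rfl

lemma redTr_intQuat_mul {x : Quaternion ℝ} (hx : redNr x = 1) (m : Quaternion ℤ) :
    redTr (intQuat m * x * star x) = 2 * m.re := by
  have h1 : x * star x = 1 := by
    rw [redNr, Quaternion.self_mul_star, Quaternion.re_coe] at hx
    rw [Quaternion.self_mul_star, hx, Quaternion.coe_one]
  rw [mul_assoc, h1, mul_one, redTr, Quaternion.re_add, Quaternion.re_star, ← two_mul]
  rfl

/-- On the diagonal, `F_n` does not depend on the point, and it is a theta series with congruence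
weight: the integral quaternions are scaled by `2`. -/
lemma thetaF_self {n : ℕ} (hn : 0 < n) {x : Quaternion ℝ} (hx : redNr x = 1) (z : UpperHalfPlane) :
    thetaF n x x z = (2 ^ n : ℂ)⁻¹ * thetaMod n (fun r => if r = 0 then 1 else 0) z := by
  set X : (Fin 4 → ℤ) → ℂ := fun m =>
    Complex.exp (Real.pi * Complex.I * (∑ i, (m i : ℂ) ^ 2) * (z / 2)) *
      zonal n (2 * m 0 : ℂ) (∑ i, (m i : ℂ) ^ 2) with hX
  have h1 : thetaMod n (fun r => if r = 0 then 1 else 0) z =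
      ∑' k : Fin 4 → ℤ, X fun i => 2 * k i := by
    have h := tsum_residue 0 X
    simp only [Pi.zero_apply, ZMod.val_zero, Nat.cast_zero, add_zero] at h
    rw [← h]
    refine tsum_congr fun m => ?_
    simp only [ite_mul, one_mul, zero_mul, hX]
  rw [h1, ← tsum_mul_left, thetaF, ← (Quaternion.equivTuple ℤ).tsum_eq]
  refine tsum_congr fun m => ?_
  rw [redTr_intQuat_mul hx, redNr_intQuat]
  set N : ℝ := (m.re : ℝ) ^ 2 + (m.imI : ℝ) ^ 2 + (m.imJ : ℝ) ^ 2 + (m.imK : ℝ) ^ 2 with hN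
  have h2 : N ^ ((n : ℝ) / 2) * chebU n (1 / (2 * √N) * (2 * m.re)) = zonal n (2 * m.re : ℝ) N := by
    have hN0 : 0 ≤ N := by positivity
    rcases hN0.eq_or_lt with h0 | h0
    · have hre : (m.re : ℝ) = 0 := by
        have : (m.re : ℝ) ^ 2 = 0 := by
          apply le_antisymm _ (sq_nonneg _)
          rw [h0, hN]
          nlinarith [sq_nonneg (m.imI : ℝ), sq_nonneg (m.imJ : ℝ), sq_nonneg (m.imK : ℝ)]
        exact pow_eq_zero_iff two_ne_zero |>.mp this
      rw [← h0, hre, mul_zero, zonal_zero hn.ne', Real.zero_rpow (by positivity), zero_mul]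
    · exact rpow_mul_chebU n h0 _
  rw [h2, ofReal_zonal]
  simp only [hX, Quaternion.equivTuple_apply, Fin.sum_univ_four, Matrix.cons_val]
  have h3 : ((2 * m.re : ℤ) : ℂ) ^ 2 + ((2 * m.imI : ℤ) : ℂ) ^ 2 + ((2 * m.imJ : ℤ) : ℂ) ^ 2 +
      ((2 * m.imK : ℤ) : ℂ) ^ 2 = 2 ^ 2 * (N : ℂ) := by
    rw [hN]; push_cast; ring
  have h4 : (2 : ℂ) * ((2 * m.re : ℤ) : ℂ) = 2 * ((2 * m.re : ℝ) : ℂ) := by push_cast; ring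
  rw [h3, h4, zonal_homogeneous]
  have h5 : Real.pi * Complex.I * (2 ^ 2 * (N : ℂ)) * (z / 2) =
      2 * Real.pi * Complex.I * N * z := by ring
  rw [h5]
  field_simp

/-! ### Fourier expansion and Parseval's identity -/

/-- The coefficient of `e(l z / 4)` in the theta series `thetaMod n φ`. -/
noncomputable def thetaCoeff (n : ℕ) (φ : (Fin 4 → ZMod 2) → ℂ) (l : ℕ) : ℂ :=
  ∑ p ∈ fourSquares l,
    φ (fun i => ((finFourEquiv ℤ).symm p i : ZMod 2)) * zonal n (2 * p.1 : ℂ) l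

lemma hasSum_thetaMod (n : ℕ) (φ : (Fin 4 → ZMod 2) → ℂ) (z : UpperHalfPlane) :
    HasSum (fun l : ℕ => thetaCoeff n φ l * Complex.exp (Real.pi * Complex.I * l * (z / 2)))
      (thetaMod n φ z) := by
  have h1 := (finFourEquiv ℤ).symm.hasSum_iff.mpr (summable_thetaMod n φ z).hasSum
  set f : ℤ × ℤ × ℤ × ℤ → ℂ := (fun m : Fin 4 → ℤ => φ (fun i => (m i : ZMod 2)) *
    (Complex.exp (Real.pi * Complex.I * (∑ i, (m i : ℂ) ^ 2) * (z / 2)) *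
      zonal n (2 * m 0 : ℂ) (∑ i, (m i : ℂ) ^ 2))) ∘ (finFourEquiv ℤ).symm with hf
  set N : ℤ × ℤ × ℤ × ℤ → ℕ := fun p =>
    (p.1 ^ 2 + p.2.1 ^ 2 + p.2.2.1 ^ 2 + p.2.2.2 ^ 2).toNat with hN
  have hmem : ∀ (l : ℕ) (p : ℤ × ℤ × ℤ × ℤ), p ∈ fourSquares l ↔ N p = l := by
    intro l p
    rw [mem_fourSquares, hN]
    have : 0 ≤ p.1 ^ 2 + p.2.1 ^ 2 + p.2.2.1 ^ 2 + p.2.2.2 ^ 2 := by positivity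
    simp only
    omega
  refine ((Equiv.sigmaFiberEquiv N).hasSum_iff.mpr h1).sigma fun l => ?_
  have hval : thetaCoeff n φ l * Complex.exp (Real.pi * Complex.I * l * (z / 2)) =
      ∑ p ∈ fourSquares l, f p := by
    rw [thetaCoeff, Finset.sum_mul]
    refine Finset.sum_congr rfl fun p hp => ?_
    rw [mem_fourSquares] at hp
    have h2 : ∑ i, ((finFourEquiv ℤ).symm p i : ℂ) ^ 2 = l := by
      rw [Fin.sum_univ_four]
      exact_mod_cast hp
    simp only [hf, Function.comp_apply, h2]
    have h3 : (finFourEquiv ℤ).symm p 0 = p.1 := rfl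
    rw [h3]
    ring
  rw [hval]
  have h4 := (fourSquares l).hasSum f
  exact (Equiv.subtypeEquivRight (hmem l)).symm.hasSum_iff.mpr h4

lemma integral_exp_pi_I (a : ℤ) :
    ∫ x : ℝ in Set.Ioc (-2) 2, Complex.exp (Real.pi * Complex.I * a / 2 * x) =
      if a = 0 then 4 else 0 := by
  rw [← intervalIntegral.integral_of_le (by norm_num)]
  split_ifs with h
  · subst h; simp; norm_num
  · have hc : (Real.pi * Complex.I * a / 2 : ℂ) ≠ 0 := by
      simp [h, Real.pi_ne_zero]
    rw [integral_exp_mul_complex hc, div_eq_zero_iff]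
    left
    rw [sub_eq_zero, Complex.exp_eq_exp_iff_exists_int]
    exact ⟨a, by push_cast; ring⟩

lemma norm_exp_pi_I (l x : ℝ) : ‖Complex.exp (Real.pi * Complex.I * l * (x / 2))‖ = 1 := by
  have : (Real.pi * Complex.I * l * (x / 2) : ℂ) = ((Real.pi * l * (x / 2) : ℝ) : ℂ) * Complex.I := by
    push_cast; ring
  rw [this, Complex.norm_exp_ofReal_mul_I]

/-- Parseval's identity over a period. -/
lemma integral_normSq_fourier {g : ℕ → ℂ} (hg : Summable fun l => ‖g l‖) :
    ∫ x : ℝ in Set.Ioc (-2) 2,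
      ‖∑' l : ℕ, g l * Complex.exp (Real.pi * Complex.I * (l : ℝ) * (x / 2))‖ ^ 2 =
        4 * ∑' l, ‖g l‖ ^ 2 := by
  set e : ℕ → ℝ → ℂ := fun l x => Complex.exp (Real.pi * Complex.I * (l : ℝ) * (x / 2)) with he
  have hnorm : ∀ l x, ‖g l * e l x‖ = ‖g l‖ := fun l x => by
    rw [norm_mul, norm_exp_pi_I, mul_one]
  have hecont : ∀ l, Continuous (e l) := fun l => by simp only [he]; fun_prop
  set P : ℕ × ℕ → ℝ → ℂ := fun p x => g p.1 * e p.1 x * star (g p.2 * e p.2 x) with hP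
  have hsq : ∀ x, ((‖∑' l : ℕ, g l * e l x‖ ^ 2 : ℝ) : ℂ) = ∑' p : ℕ × ℕ, P p x := fun x => by
    have hs : Summable fun l => ‖g l * e l x‖ := hg.congr fun l => (hnorm l x).symm
    have hs' : Summable fun l => ‖star (g l * e l x)‖ := by simpa using hs
    rw [hP, ← tsum_mul_tsum_of_summable_norm hs hs', ← tsum_star]
    rw [Complex.star_def, Complex.mul_conj, Complex.normSq_eq_norm_sq]
  have hnP : ∀ p x, ‖P p x‖ = ‖g p.1‖ * ‖g p.2‖ := fun p x => by
    simp only [hP]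
    rw [norm_mul, norm_star, hnorm, hnorm]
  have hPint : ∀ p, Integrable (P p) (volume.restrict (Set.Ioc (-2 : ℝ) 2)) := fun p => by
    have hc : Continuous (P p) := by
      simp only [hP]
      exact (continuous_const.mul (hecont _)).mul (continuous_const.mul (hecont _)).star
    exact (hc.integrableOn_Icc).mono_set Set.Ioc_subset_Icc_self
  have hval : ∀ p : ℕ × ℕ, ∫ x in Set.Ioc (-2 : ℝ) 2, P p x =
      if p.1 = p.2 then ((4 * ‖g p.1‖ ^ 2 : ℝ) : ℂ) else 0 := fun p => by
    have h1 : ∀ x, P p x = g p.1 * star (g p.2) *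
        Complex.exp (Real.pi * Complex.I * ((p.1 : ℤ) - (p.2 : ℤ) : ℤ) / 2 * x) := fun x => by
      simp only [hP, he, star_mul', Complex.star_def, ← Complex.exp_conj]
      have h2 : ∀ a b c d : ℂ, a * b * (c * d) = a * c * (b * d) := fun a b c d => by ring
      rw [h2, ← Complex.exp_add]
      congr 2
      simp only [map_mul, map_div₀, Complex.conj_I, Complex.conj_ofReal, map_ofNat]
      push_cast
      ring
    simp_rw [h1]
    rw [integral_const_mul, integral_exp_pi_I]
    by_cases h : p.1 = p.2
    · rw [if_pos (by omega), if_pos h, ← h, Complex.star_def, Complex.mul_conj,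
        Complex.normSq_eq_norm_sq]
      push_cast; ring
    · rw [if_neg (by omega), if_neg h, mul_zero]
  have hsum : Summable fun p : ℕ × ℕ => ∫ x in Set.Ioc (-2 : ℝ) 2, ‖P p x‖ := by
    simp_rw [hnP, setIntegral_const]
    exact (hg.mul_of_nonneg hg (fun _ => norm_nonneg _) fun _ => norm_nonneg _).const_smul _
  have key := hasSum_integral_of_summable_integral_norm hPint hsum
  simp_rw [hval, ← hsq] at key
  rw [integral_complex_ofReal] at key
  have hinj : Function.Injective fun l : ℕ => (l, l) := fun a b h => by simpa using h
  rw [← hinj.hasSum_iff] at key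
  · have h3 : (fun p : ℕ × ℕ => if p.1 = p.2 then ((4 * ‖g p.1‖ ^ 2 : ℝ) : ℂ) else 0) ∘
        (fun l : ℕ => (l, l)) = fun l => ((4 * ‖g l‖ ^ 2 : ℝ) : ℂ) := by
      ext l; simp
    rw [h3, Complex.hasSum_ofReal] at key
    rw [← tsum_mul_left]
    exact key.tsum_eq.symm
  · intro p hp
    rw [if_neg]
    intro h
    exact hp ⟨p.1, Prod.ext rfl h⟩

lemma lintegral_normSq_fourier {g : ℕ → ℂ} (hg : Summable fun l => ‖g l‖) :
    ∫⁻ x : ℝ in Set.Ioc (-2) 2, ENNReal.ofReal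
      (‖∑' l : ℕ, g l * Complex.exp (Real.pi * Complex.I * (l : ℝ) * (x / 2))‖ ^ 2) =
        ENNReal.ofReal (4 * ∑' l, ‖g l‖ ^ 2) := by
  rw [← integral_normSq_fourier hg, ofReal_integral_eq_lintegral_ofReal]
  · have hc : Continuous fun x : ℝ =>
        ∑' l : ℕ, g l * Complex.exp (Real.pi * Complex.I * (l : ℝ) * (x / 2)) :=
      continuous_tsum (fun l => by fun_prop) hg fun l x => by
        rw [norm_mul, norm_exp_pi_I, mul_one]
    exact ((hc.norm.pow 2).integrableOn_Icc).mono_set Set.Ioc_subset_Icc_self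
  · exact Filter.Eventually.of_forall fun x => by positivity

/-! ### The integral over the fundamental domain -/

lemma volume_restrict_map_coe :
    ((volume : Measure ℂ).comap UpperHalfPlane.coe).map UpperHalfPlane.coe ≤ volume := by
  rw [UpperHalfPlane.measurableEmbedding_coe.map_comap]
  exact Measure.restrict_le_self

/-- The integral over the standard fundamental domain is at most the integral over the strip
`-2 < x ≤ 2`, `1 / 2 ≤ y`, written in Cartesian coordinates. -/
lemma lintegral_fd_le (G : ℂ → ℝ) (n : ℕ) :
    ∫⁻ z : UpperHalfPlane in ModularGroup.fd, ENNReal.ofReal (G z * z.im ^ (n + 2)) ≤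
      ∫⁻ y : ℝ in Set.Ici (1 / 2), ∫⁻ x : ℝ in Set.Ioc (-2) 2,
        ENNReal.ofReal (G (x + y * Complex.I) * y ^ n) := by
  set H : ℂ → ENNReal := {w : ℂ | w.im ∈ Set.Ici (1 / 2) ∧ w.re ∈ Set.Ioc (-2) 2}.indicator
    fun w => ENNReal.ofReal (G w * w.im ^ n) with hH
  have hcoe := UpperHalfPlane.measurableEmbedding_coe
  have hdens : Measurable fun z : UpperHalfPlane =>
      (((1 / NNReal.mk z.im z.im_pos.le : NNReal) ^ 2 : NNReal) : ENNReal) := by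
    refine measurable_coe_nnreal_ennreal.comp (Continuous.measurable ?_)
    refine .pow (.div₀ continuous_const ?_ ?_) _
    · exact UpperHalfPlane.continuous_im.subtype_mk _
    · exact fun x ↦ NNReal.ne_iff.mp x.im_ne_zero
  rw [← lintegral_indicator ModularGroup.isClosed_fd.measurableSet, UpperHalfPlane.volume_def]
  refine (lintegral_withDensity_le_lintegral_mul _ hdens _).trans ?_
  calc _ ≤ ∫⁻ z : UpperHalfPlane, H z ∂(volume.comap UpperHalfPlane.coe) := by
        refine lintegral_mono fun z => ?_
        simp only [Pi.mul_apply]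
        by_cases hz : z ∈ ModularGroup.fd
        · have h1 : (z : ℂ) ∈ {w : ℂ | w.im ∈ Set.Ici (1 / 2) ∧ w.re ∈ Set.Ioc (-2) 2} := by
            have h3 := ModularGroup.three_le_four_mul_im_sq_of_mem_fd hz
            have h4 := abs_le.mp hz.2
            have h5 := z.im_pos
            refine ⟨?_, ?_, ?_⟩
            · rw [Set.mem_Ici, UpperHalfPlane.coe_im]; nlinarith
            · rw [UpperHalfPlane.coe_re]; linarith
            · rw [UpperHalfPlane.coe_re]; linarith
          rw [Set.indicator_of_mem hz, hH, Set.indicator_of_mem h1, ← ENNReal.ofReal_coe_nnreal,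
            ← ENNReal.ofReal_mul (by positivity)]
          apply ENNReal.ofReal_le_ofReal
          have h5 := z.im_ne_zero
          push_cast
          rw [UpperHalfPlane.coe_im]
          apply le_of_eq
          field_simp
          ring
        · rw [Set.indicator_of_notMem hz, mul_zero]
          exact zero_le
    _ = ∫⁻ w : ℂ, H w ∂((volume.comap UpperHalfPlane.coe).map UpperHalfPlane.coe) :=
        (hcoe.lintegral_map H).symm
    _ ≤ ∫⁻ w : ℂ, H w := lintegral_mono' volume_restrict_map_coe le_rfl
    _ = ∫⁻ p : ℝ × ℝ, H (Complex.measurableEquivRealProd.symm p) :=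
        (Complex.volume_preserving_equiv_real_prod.symm.lintegral_comp_emb
          Complex.measurableEquivRealProd.symm.measurableEmbedding H).symm
    _ = ∫⁻ p : ℝ × ℝ, H (Complex.measurableEquivRealProd.symm p.swap) := by
        rw [Measure.volume_eq_prod]
        exact (lintegral_prod_swap (μ := volume) (ν := volume) _).symm
    _ ≤ ∫⁻ y : ℝ, ∫⁻ x : ℝ, H (Complex.measurableEquivRealProd.symm (x, y)) := by
        rw [Measure.volume_eq_prod]
        exact lintegral_prod_le _
    _ = _ := by
        rw [← lintegral_indicator measurableSet_Ici]
        refine lintegral_congr fun y => ?_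
        by_cases hy : y ∈ Set.Ici (1 / 2 : ℝ)
        · rw [Set.indicator_of_mem hy, ← lintegral_indicator measurableSet_Ioc]
          refine lintegral_congr fun x => ?_
          have e1 : Complex.measurableEquivRealProd.symm (x, y) = x + y * Complex.I := by
            apply Complex.ext <;> simp [Complex.measurableEquivRealProd_symm_apply]
          rw [e1, hH]
          by_cases hx : x ∈ Set.Ioc (-2 : ℝ) 2
          · rw [Set.indicator_of_mem hx, Set.indicator_of_mem]
            · simp
            · simpa using And.intro hy hx
          · rw [Set.indicator_of_notMem hx, Set.indicator_of_notMem]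
            intro h
            exact hx (by simpa using h.2)
        · have h0 : ∀ x : ℝ, H (Complex.measurableEquivRealProd.symm (x, y)) = 0 := fun x => by
            rw [hH, Set.indicator_of_notMem]
            intro h
            exact hy (by simpa using h.1)
          rw [Set.indicator_of_notMem hy]
          simp_rw [h0, lintegral_zero]

/-- The weight with which the square of the `l`-th Fourier coefficient enters the norm. -/
noncomputable def cuspWeight (n l : ℕ) : ENNReal :=
  ∫⁻ y : ℝ in Set.Ici (1 / 2), ENNReal.ofReal (y ^ n * Real.exp (-Real.pi * l * y))

lemma lintegral_thetaMod_le (n : ℕ) (φ : (Fin 4 → ZMod 2) → ℂ) :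
    ∫⁻ z : UpperHalfPlane in ModularGroup.fd,
        ENNReal.ofReal (‖thetaMod n φ z‖ ^ 2 * z.im ^ (n + 2)) ≤
      ∑' l : ℕ, ENNReal.ofReal (4 * ‖thetaCoeff n φ l‖ ^ 2) * cuspWeight n l := by
  set G : ℂ → ℝ := fun w =>
    ‖∑' l : ℕ, thetaCoeff n φ l * Complex.exp (Real.pi * Complex.I * l * (w / 2))‖ ^ 2 with hG
  have h1 : ∀ z : UpperHalfPlane, ‖thetaMod n φ z‖ ^ 2 = G z := fun z => by
    rw [hG, ← (hasSum_thetaMod n φ z).tsum_eq]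
  simp_rw [h1]
  refine (lintegral_fd_le G n).trans ?_
  have hfib : ∀ y ∈ Set.Ici (1 / 2 : ℝ), ∫⁻ x : ℝ in Set.Ioc (-2) 2,
      ENNReal.ofReal (G (x + y * Complex.I) * y ^ n) = ∑' l : ℕ,
        ENNReal.ofReal (4 * ‖thetaCoeff n φ l‖ ^ 2) *
          ENNReal.ofReal (y ^ n * Real.exp (-Real.pi * l * y)) := by
    intro y hy
    have hy0 : 0 < y := lt_of_lt_of_le (by norm_num) (Set.mem_Ici.mp hy)
    set g : ℕ → ℂ := fun l => thetaCoeff n φ l * Complex.exp (-Real.pi * l * (y / 2)) with hg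
    have hgn : ∀ l, ‖g l‖ = ‖thetaCoeff n φ l‖ * Real.exp (-Real.pi * l * (y / 2)) := fun l => by
      rw [hg, norm_mul, Complex.norm_exp]
      congr 2
      have : (-Real.pi * l * (y / 2) : ℂ) = ((-Real.pi * l * (y / 2) : ℝ) : ℂ) := by push_cast; rfl
      rw [this, Complex.ofReal_re]
    have hgs : Summable fun l => ‖g l‖ := by
      refine (hasSum_thetaMod n φ ⟨y * Complex.I, by simpa using hy0⟩).summable.norm.congr
        fun l => ?_
      rw [hg]
      congr 3
      simp only
      linear_combination (Real.pi * l * (y / 2) : ℂ) * Complex.I_sq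
    have hgn2 : ∀ l, 4 * ‖g l‖ ^ 2 * y ^ n =
        4 * ‖thetaCoeff n φ l‖ ^ 2 * (y ^ n * Real.exp (-Real.pi * l * y)) := fun l => by
      have : Real.exp (-Real.pi * l * y) = Real.exp (-Real.pi * l * (y / 2)) ^ 2 := by
        rw [← Real.exp_nat_mul]; congr 1; push_cast; ring
      rw [hgn, this]; ring
    have hgs2 : Summable fun l => ‖g l‖ ^ 2 := by
      have h0 := (hgs.mul_of_nonneg hgs (fun _ => norm_nonneg _) fun _ => norm_nonneg _).comp_injective
        (i := fun l : ℕ => (l, l)) (fun a b h => by simpa using h)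
      exact h0.congr fun l => by simp [sq]
    calc _ = ∫⁻ x : ℝ in Set.Ioc (-2) 2, ENNReal.ofReal
          (‖∑' l : ℕ, g l * Complex.exp (Real.pi * Complex.I * (l : ℝ) * (x / 2))‖ ^ 2) *
            ENNReal.ofReal (y ^ n) := by
          refine lintegral_congr fun x => ?_
          rw [← ENNReal.ofReal_mul (by positivity), hG]
          simp only
          congr 4
          refine tsum_congr fun l => ?_
          rw [hg]
          simp only
          rw [mul_assoc (thetaCoeff n φ l), ← Complex.exp_add]
          congr 2
          push_cast
          linear_combination (Real.pi * l * (y / 2) : ℂ) * Complex.I_sq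
      _ = ENNReal.ofReal (4 * ∑' l, ‖g l‖ ^ 2) * ENNReal.ofReal (y ^ n) := by
          rw [lintegral_mul_const' _ _ ENNReal.ofReal_ne_top, lintegral_normSq_fourier hgs]
      _ = _ := by
          rw [← ENNReal.ofReal_mul (by positivity), ← tsum_mul_left, ← tsum_mul_right,
            ENNReal.ofReal_tsum_of_nonneg (fun l => by positivity)
              ((hgs2.mul_left 4).mul_right _)]
          refine tsum_congr fun l => ?_
          rw [hgn2, ENNReal.ofReal_mul (by positivity)]
  rw [setLIntegral_congr_fun measurableSet_Ici hfib, lintegral_tsum]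
  · refine ENNReal.tsum_le_tsum fun l => ?_
    rw [lintegral_const_mul' _ _ ENNReal.ofReal_ne_top, cuspWeight]
  · intro l
    fun_prop

/-- As `1 ≤ 2 y` in the range of integration, the integrand may be multiplied by `(2 y) ^ A`, which
trades powers of `n` for powers of `l`. -/
lemma cuspWeight_le (n : ℕ) {l : ℕ} (hl : l ≠ 0) {A : ℝ} (hA : 0 ≤ A) :
    cuspWeight n l ≤ ENNReal.ofReal
      (2 ^ A * ((1 / (Real.pi * l)) ^ (n + 1 + A) * Real.Gamma (n + 1 + A))) := by
  have hr : 0 < Real.pi * l := by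
    have : (0 : ℝ) < l := by positivity
    positivity
  have ha : 0 < n + 1 + A := by positivity
  rw [← Real.integral_rpow_mul_exp_neg_mul_Ioi ha hr, ENNReal.ofReal_mul (by positivity),
    ofReal_integral_eq_lintegral_ofReal]
  · rw [← lintegral_const_mul' _ _ ENNReal.ofReal_ne_top, cuspWeight]
    refine (setLIntegral_mono' measurableSet_Ici fun y hy => ?_).trans
      (lintegral_mono_set (s := Set.Ici (1 / 2)) fun y hy =>
        lt_of_lt_of_le (by norm_num : (0 : ℝ) < 1 / 2) hy)
    have hy2 : (1 : ℝ) ≤ 2 * y := by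
      have := Set.mem_Ici.mp hy; linarith
    have hy0 : 0 < y := by linarith
    rw [← ENNReal.ofReal_mul (by positivity)]
    apply ENNReal.ofReal_le_ofReal
    have h1 : (2 : ℝ) ^ A * (y ^ (n + 1 + A - 1) * Real.exp (-(Real.pi * l * y))) =
        (2 * y) ^ A * (y ^ n * Real.exp (-Real.pi * l * y)) := by
      have : (n : ℝ) + 1 + A - 1 = n + A := by ring
      rw [this, Real.rpow_add hy0, Real.rpow_natCast, Real.mul_rpow (by norm_num) hy0.le]
      ring_nf
    rw [h1]
    exact le_mul_of_one_le_left (by positivity) (Real.one_le_rpow hy2 hA)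
  · have := integrableOn_rpow_mul_exp_neg_mul_rpow (s := n + 1 + A - 1) (p := 1) (by linarith)
      one_pos hr
    refine this.congr_fun (fun y _ => ?_) measurableSet_Ioi
    simp only [Real.rpow_one, neg_mul]
  · refine (ae_restrict_iff' measurableSet_Ioi).mpr (Filter.Eventually.of_forall fun y hy => ?_)
    have : 0 < y := hy
    positivity

/-! ### The bound for the Petersson norm -/

/-- The weight `φ` enters the bound for the coefficients only through a factor independent of `n`. -/
lemma norm_thetaCoeff_le (n : ℕ) (φ : (Fin 4 → ZMod 2) → ℂ) {l : ℕ} (hl : l ≠ 0) :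
    ‖thetaCoeff n φ l‖ ≤
      (∑ r, ‖φ r‖) * ((l : ℝ) ^ ((n : ℝ) / 2) * ∑ p ∈ fourSquares l, |chebU n (p.1 / √l)|) := by
  have hl0 : (0 : ℝ) < l := by positivity
  rw [thetaCoeff, Finset.mul_sum, Finset.mul_sum]
  refine (norm_sum_le _ _).trans (Finset.sum_le_sum fun p _ => ?_)
  rw [norm_mul]
  gcongr
  · exact Finset.single_le_sum (f := fun r => ‖φ r‖) (fun _ _ => norm_nonneg _) (Finset.mem_univ _)
  · have h1 : zonal n (2 * p.1 : ℂ) l = ((zonal n (2 * p.1 : ℝ) l : ℝ) : ℂ) := by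
      rw [ofReal_zonal]; push_cast; rfl
    have h2 : 1 / (2 * √l) * (2 * p.1 : ℝ) = p.1 / √l := by field_simp
    rw [h1, ← rpow_mul_chebU n hl0, h2, Complex.norm_real, Real.norm_eq_abs, abs_mul,
      abs_of_nonneg (by positivity)]

lemma thetaCoeff_zero {n : ℕ} (hn : n ≠ 0) (φ : (Fin 4 → ZMod 2) → ℂ) : thetaCoeff n φ 0 = 0 := by
  refine Finset.sum_eq_zero fun p hp => ?_
  rw [mem_fourSquares] at hp
  have h1 : p.1 = 0 := by
    have : p.1 ^ 2 = 0 := by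
      push_cast at hp
      nlinarith [sq_nonneg p.1, sq_nonneg p.2.1, sq_nonneg p.2.2.1, sq_nonneg p.2.2.2]
    exact pow_eq_zero_iff two_ne_zero |>.mp this
  rw [h1]
  simp [zonal_zero hn]

/-- Log-convexity of the Gamma function between `n + 3` and `n + 4`. -/
lemma Gamma_add_two_add_le {n : ℕ} (hn : 0 < n) {δ : ℝ} (hδ : 0 < δ) (hδ1 : δ ≤ 1) :
    Real.Gamma (n + 1 + (2 + δ)) ≤ 12 * (Real.Gamma (n + 2) * (n : ℝ) ^ (1 + δ)) := by
  have hn1 : (1 : ℝ) ≤ n := by exact_mod_cast hn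
  have hG : 0 < Real.Gamma ((n : ℝ) + 2) := Real.Gamma_pos_of_pos (by positivity)
  have h3 : Real.Gamma ((n : ℝ) + 3) = (n + 2) * Real.Gamma (n + 2) := by
    rw [← Real.Gamma_add_one (by positivity)]; congr 1; ring
  have hG3 : 0 < Real.Gamma ((n : ℝ) + 3) := Real.Gamma_pos_of_pos (by positivity)
  have h4 : Real.Gamma ((n : ℝ) + 4) = (n + 3) * Real.Gamma (n + 3) := by
    rw [← Real.Gamma_add_one (by positivity)]; congr 1; ring
  have h5 : Real.Gamma (n + 1 + (2 + δ)) ≤ Real.Gamma (n + 3) * ((n : ℝ) + 3) ^ δ := by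
    rcases hδ1.eq_or_lt with rfl | hlt
    · rw [Real.rpow_one, mul_comm, ← h4]
      apply le_of_eq; congr 1; ring
    · have h := Real.Gamma_mul_add_mul_le_rpow_Gamma_mul_rpow_Gamma (s := (n : ℝ) + 3)
        (t := (n : ℝ) + 4) (a := 1 - δ) (b := δ) (by positivity) (by positivity) (by linarith) hδ
        (by ring)
      have e : (1 - δ) * ((n : ℝ) + 3) + δ * (n + 4) = n + 1 + (2 + δ) := by ring
      rw [e, h4, Real.mul_rpow (by positivity) hG3.le, mul_left_comm,
        ← Real.rpow_add hG3, sub_add_cancel, Real.rpow_one] at h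
      linarith
  have h6 : ((n : ℝ) + 3) ^ δ ≤ 4 * (n : ℝ) ^ δ := by
    calc ((n : ℝ) + 3) ^ δ ≤ (4 * (n : ℝ)) ^ δ :=
          Real.rpow_le_rpow (by positivity) (by linarith) hδ.le
      _ = 4 ^ δ * (n : ℝ) ^ δ := Real.mul_rpow (by norm_num) (by positivity)
      _ ≤ 4 ^ (1 : ℝ) * (n : ℝ) ^ δ := by
          gcongr
          norm_num
      _ = 4 * (n : ℝ) ^ δ := by rw [Real.rpow_one]
  calc _ ≤ _ := h5
    _ ≤ (3 * n * Real.Gamma (n + 2)) * (4 * (n : ℝ) ^ δ) := by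
        rw [h3]
        gcongr
        linarith
    _ = _ := by rw [Real.rpow_add (by positivity), Real.rpow_one]; ring

/-- The contribution of one Fourier coefficient. The exponent `A = 2 + δ` in the bound for
`cuspWeight` makes the generic part of the coefficient summable over `l`, while `A = 0` serves for
the part supported on squares. -/
lemma sq_mul_cuspWeight_le {C ε δ : ℝ} (hδ : 0 < δ) (hδ1 : δ ≤ 1)
    (hε : ε = δ / 4) {n l : ℕ} (hn : 0 < n) (hl : l ≠ 0) {b : ℝ} (hb0 : 0 ≤ b)
    (hb : b ≤ C * (l * (l : ℝ) ^ ε) + (n + 1) * if IsSquare l then 2 else 0) :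
    ENNReal.ofReal ((l : ℝ) ^ n * b ^ 2) * cuspWeight n l ≤
      ENNReal.ofReal (Real.pi ^ (-(n : ℝ)) * Real.Gamma (n + 2) * (n : ℝ) ^ (1 + δ) *
        (192 * C ^ 2 * (l : ℝ) ^ (-1 - δ / 2) + 16 * if IsSquare l then 1 / (l : ℝ) else 0)) := by
  have hl0 : (0 : ℝ) < l := by positivity
  have hn1 : (1 : ℝ) ≤ n := by exact_mod_cast hn
  have hG : 0 < Real.Gamma ((n : ℝ) + 2) := Real.Gamma_pos_of_pos (by positivity)
  have hπ : 1 ≤ Real.pi := by linarith [Real.pi_gt_three]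
  set s : ℝ := if IsSquare l then 1 else 0 with hs
  have hs0 : 0 ≤ s := by rw [hs]; split_ifs <;> norm_num
  have hss : s ^ 2 = s := by rw [hs]; split_ifs <;> norm_num
  have hs2 : (if IsSquare l then (2 : ℝ) else 0) = 2 * s := by rw [hs]; split_ifs <;> norm_num
  have hsl : (if IsSquare l then 1 / (l : ℝ) else 0) = s / l := by
    rw [hs]; split_ifs <;> simp
  have hb2 : b ^ 2 ≤ 2 * C ^ 2 * (l : ℝ) ^ (2 + δ / 2) + 8 * (n + 1) ^ 2 * s := by
    have h1 : b ^ 2 ≤ (C * (l * (l : ℝ) ^ ε) + (n + 1) * (2 * s)) ^ 2 := by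
      rw [hs2] at hb; gcongr
    have h2 : ((l : ℝ) * (l : ℝ) ^ ε) ^ 2 = (l : ℝ) ^ (2 + δ / 2) := by
      rw [mul_pow, ← Real.rpow_natCast ((l : ℝ) ^ ε), ← Real.rpow_mul hl0.le,
        Real.rpow_add hl0, Real.rpow_two, hε]
      congr 2; push_cast; ring
    rw [← h2, ← hss]
    nlinarith [sq_nonneg (C * (l * (l : ℝ) ^ ε) - (n + 1) * (2 * s))]
  have hw1 := cuspWeight_le n hl (A := 2 + δ) (by linarith)
  have hw2 := cuspWeight_le n hl (A := 0) le_rfl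
  have e1 : (l : ℝ) ^ n * (2 * C ^ 2 * (l : ℝ) ^ (2 + δ / 2)) * (2 ^ (2 + δ) *
      ((1 / (Real.pi * l)) ^ (n + 1 + (2 + δ)) * Real.Gamma (n + 1 + (2 + δ)))) ≤
      Real.pi ^ (-(n : ℝ)) * Real.Gamma (n + 2) * (n : ℝ) ^ (1 + δ) *
        (192 * C ^ 2 * (l : ℝ) ^ (-1 - δ / 2)) := by
    have h2 : (2 : ℝ) ^ (2 + δ) ≤ 8 := by
      calc (2 : ℝ) ^ (2 + δ) ≤ 2 ^ (3 : ℝ) :=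
            Real.rpow_le_rpow_of_exponent_le (by norm_num) (by linarith)
        _ = 8 := by norm_num
    have h3 : (1 / (Real.pi * l)) ^ (n + 1 + (2 + δ)) ≤
        Real.pi ^ (-(n : ℝ)) * (l : ℝ) ^ (-(n + 1 + (2 + δ))) := by
      rw [one_div, Real.inv_rpow (by positivity), ← Real.rpow_neg (by positivity),
        Real.mul_rpow (by positivity) (by positivity)]
      gcongr
      linarith
    have h4 : (l : ℝ) ^ n * (l : ℝ) ^ (2 + δ / 2) * (l : ℝ) ^ (-(n + 1 + (2 + δ))) =
        (l : ℝ) ^ (-1 - δ / 2) := by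
      rw [← Real.rpow_natCast, ← Real.rpow_add hl0, ← Real.rpow_add hl0]
      congr 1; ring
    calc _ ≤ (l : ℝ) ^ n * (2 * C ^ 2 * (l : ℝ) ^ (2 + δ / 2)) * (8 *
          ((Real.pi ^ (-(n : ℝ)) * (l : ℝ) ^ (-(n + 1 + (2 + δ)))) *
            (12 * (Real.Gamma (n + 2) * (n : ℝ) ^ (1 + δ))))) := by
          have := Gamma_add_two_add_le hn hδ hδ1
          have h0 : 0 ≤ Real.Gamma ((n : ℝ) + 1 + (2 + δ)) :=
            (Real.Gamma_pos_of_pos (by positivity)).le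
          gcongr
      _ = _ := by rw [← h4]; ring
  have e2 : (l : ℝ) ^ n * (8 * (n + 1) ^ 2 * s) * (2 ^ (0 : ℝ) *
      ((1 / (Real.pi * l)) ^ ((n : ℝ) + 1 + 0) * Real.Gamma (n + 1 + 0))) ≤
      Real.pi ^ (-(n : ℝ)) * Real.Gamma (n + 2) * (n : ℝ) ^ (1 + δ) * (16 * (s / l)) := by
    have h3 : (1 / (Real.pi * l)) ^ ((n : ℝ) + 1 + 0) ≤
        Real.pi ^ (-(n : ℝ)) * ((l : ℝ) ^ n * l)⁻¹ := by
      rw [one_div, Real.inv_rpow (by positivity), ← Real.rpow_neg (by positivity),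
        Real.mul_rpow (by positivity) (by positivity), add_zero, Real.rpow_neg hl0.le,
        ← pow_succ, ← Real.rpow_natCast (l : ℝ) (n + 1)]
      push_cast
      gcongr
      linarith
    have h4 : Real.Gamma ((n : ℝ) + 2) = (n + 1) * Real.Gamma (n + 1) := by
      rw [← Real.Gamma_add_one (by positivity)]; congr 1; ring
    have hG1 : 0 < Real.Gamma ((n : ℝ) + 1) := Real.Gamma_pos_of_pos (by positivity)
    have h5 : (n : ℝ) + 1 ≤ 2 * (n : ℝ) ^ (1 + δ) := by
      have : (n : ℝ) ^ (1 : ℝ) ≤ (n : ℝ) ^ (1 + δ) :=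
        Real.rpow_le_rpow_of_exponent_le hn1 (by linarith)
      rw [Real.rpow_one] at this
      linarith
    rw [Real.rpow_zero, one_mul]
    calc _ ≤ (l : ℝ) ^ n * (8 * (n + 1) ^ 2 * s) *
          ((Real.pi ^ (-(n : ℝ)) * ((l : ℝ) ^ n * l)⁻¹) * Real.Gamma (n + 1)) := by
          rw [add_zero (n + 1 : ℝ)] at h3 ⊢
          gcongr
      _ = Real.pi ^ (-(n : ℝ)) * ((n + 1) * Real.Gamma (n + 1)) * (n + 1) * (8 * (s / l)) := by
          field_simp
      _ ≤ Real.pi ^ (-(n : ℝ)) * Real.Gamma (n + 2) * (2 * (n : ℝ) ^ (1 + δ)) * (8 * (s / l)) := by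
          rw [h4]; gcongr
      _ = _ := by ring
  rw [hsl]
  calc _ ≤ ENNReal.ofReal ((l : ℝ) ^ n * (2 * C ^ 2 * (l : ℝ) ^ (2 + δ / 2)) +
        (l : ℝ) ^ n * (8 * (n + 1) ^ 2 * s)) * cuspWeight n l := by
        gcongr
        rw [← mul_add]
        gcongr
    _ ≤ _ := by
        rw [ENNReal.ofReal_add (by positivity) (by positivity), add_mul,
          mul_add (Real.pi ^ (-(n : ℝ)) * Real.Gamma (n + 2) * (n : ℝ) ^ (1 + δ)),
          ENNReal.ofReal_add (by positivity) (by positivity)]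
        refine add_le_add ?_ ?_
        · refine (mul_le_mul_right hw1 _).trans ?_
          rw [← ENNReal.ofReal_mul (by positivity)]
          exact ENNReal.ofReal_le_ofReal e1
        · refine (mul_le_mul_right hw2 _).trans ?_
          rw [← ENNReal.ofReal_mul (by positivity)]
          exact ENNReal.ofReal_le_ofReal e2

lemma summable_isSquare_div : Summable fun l : ℕ => if IsSquare l then 1 / (l : ℝ) else 0 := by
  have hinj : Function.Injective fun r : ℕ => r * r := fun a b h => Nat.mul_self_inj.mp h
  rw [← hinj.summable_iff]
  · refine (Real.summable_one_div_nat_pow.mpr one_lt_two).congr fun r => ?_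
    simp [sq]
  · intro l hl
    rw [if_neg]
    rintro ⟨r, rfl⟩
    exact hl ⟨r, rfl⟩

/-- The norm over the standard fundamental domain of a theta series with a given weight `φ`. -/
lemma exists_lintegral_thetaMod_le {δ : ℝ} (hδ : 0 < δ) (hδ1 : δ ≤ 1)
    (φ : (Fin 4 → ZMod 2) → ℂ) : ∃ K : ℝ, 0 ≤ K ∧ ∀ n : ℕ, 0 < n →
      ∫⁻ z : UpperHalfPlane in ModularGroup.fd,
        ENNReal.ofReal (‖thetaMod n φ z‖ ^ 2 * z.im ^ (n + 2)) ≤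
      ENNReal.ofReal (K * (Real.pi ^ (-(n : ℝ)) * Real.Gamma (n + 2) * (n : ℝ) ^ (1 + δ))) := by
  obtain ⟨C, hC, hb⟩ := exists_sum_abs_chebU_le (ε := δ / 4) (by positivity)
  set Φ : ℝ := ∑ r, ‖φ r‖ with hΦ
  set w : ℕ → ℝ := fun l =>
    192 * C ^ 2 * (l : ℝ) ^ (-1 - δ / 2) + 16 * if IsSquare l then 1 / (l : ℝ) else 0 with hw
  have hw0 : ∀ l, 0 ≤ w l := fun l => by
    have : 0 ≤ if IsSquare l then 1 / (l : ℝ) else 0 := by split_ifs <;> positivity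
    positivity
  have hws : Summable w :=
    ((Real.summable_nat_rpow.mpr (by linarith)).mul_left _).add (summable_isSquare_div.mul_left _)
  refine ⟨4 * Φ ^ 2 * ∑' l, w l, mul_nonneg (by positivity) (tsum_nonneg hw0), fun n hn => ?_⟩
  have hG : 0 < Real.Gamma ((n : ℝ) + 2) := Real.Gamma_pos_of_pos (by positivity)
  set M : ℝ := Real.pi ^ (-(n : ℝ)) * Real.Gamma (n + 2) * (n : ℝ) ^ (1 + δ) with hM
  have hM0 : 0 ≤ M := by positivity
  refine (lintegral_thetaMod_le n φ).trans ?_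
  have hterm : ∀ l : ℕ, ENNReal.ofReal (4 * ‖thetaCoeff n φ l‖ ^ 2) * cuspWeight n l ≤
      ENNReal.ofReal (4 * Φ ^ 2 * M * w l) := by
    intro l
    rcases eq_or_ne l 0 with rfl | hl
    · rw [thetaCoeff_zero hn.ne']; simp
    set b : ℝ := ∑ p ∈ fourSquares l, |chebU n (p.1 / √l)| with hbdef
    have hb0 : 0 ≤ b := Finset.sum_nonneg fun _ _ => abs_nonneg _
    have h1 : 4 * ‖thetaCoeff n φ l‖ ^ 2 ≤ 4 * Φ ^ 2 * ((l : ℝ) ^ n * b ^ 2) := by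
      have h2 : ((l : ℝ) ^ ((n : ℝ) / 2)) ^ 2 = (l : ℝ) ^ n := by
        rw [← Real.rpow_natCast, ← Real.rpow_mul (by positivity), ← Real.rpow_natCast]
        congr 1; push_cast; ring
      calc 4 * ‖thetaCoeff n φ l‖ ^ 2 ≤ 4 * (Φ * ((l : ℝ) ^ ((n : ℝ) / 2) * b)) ^ 2 := by
            gcongr
            exact norm_thetaCoeff_le n φ hl
        _ = _ := by rw [← h2]; ring
    calc _ ≤ ENNReal.ofReal (4 * Φ ^ 2 * ((l : ℝ) ^ n * b ^ 2)) * cuspWeight n l := by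
          gcongr
      _ = ENNReal.ofReal (4 * Φ ^ 2) *
            (ENNReal.ofReal ((l : ℝ) ^ n * b ^ 2) * cuspWeight n l) := by
          rw [ENNReal.ofReal_mul (by positivity), mul_assoc]
      _ ≤ ENNReal.ofReal (4 * Φ ^ 2) * ENNReal.ofReal (M * w l) := by
          gcongr
          exact sq_mul_cuspWeight_le hδ hδ1 rfl hn hl hb0 (hb n l hl)
      _ = _ := by rw [← ENNReal.ofReal_mul (by positivity)]; congr 1; ring
  refine (ENNReal.tsum_le_tsum hterm).trans ?_
  rw [← ENNReal.ofReal_tsum_of_nonneg (fun l => mul_nonneg (by positivity) (hw0 l))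
    (hws.mul_left _), tsum_mul_left]
  apply le_of_eq
  congr 1; ring

/-- The integral over the quotient of the upper half-plane by `Γ` is at most a sum over the
cosets of integrals over the standard fundamental domain. -/
lemma lintegral_fundDomain_le (Γ : Subgroup SL(2, ℤ)) [Fintype (SL(2, ℤ) ⧸ Γ)]
    (g : UpperHalfPlane → ENNReal) :
    ∫⁻ z in fundDomain Γ, g z ≤ ∑ q : SL(2, ℤ) ⧸ Γ, ∫⁻ z in ModularGroup.fd, g (q.out⁻¹ • z) := by
  refine (lintegral_iUnion_le _ _).trans ?_
  rw [tsum_fintype]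
  refine Finset.sum_le_sum fun q _ => le_of_eq ?_
  have hmp : MeasurePreserving (fun z : UpperHalfPlane => q.out • z) volume volume :=
    measurePreserving_smul (Matrix.SpecialLinearGroup.mapGL ℝ q.out) volume
  have hemb : MeasurableEmbedding (fun z : UpperHalfPlane => q.out • z) :=
    measurableEmbedding_const_smul (Matrix.SpecialLinearGroup.mapGL ℝ q.out)
  rw [← hmp.setLIntegral_comp_preimage_emb hemb (fun w => g (q.out⁻¹ • w))]
  simp only [inv_smul_smul]
  rfl

lemma enorm_petersson (n : ℕ) (f : UpperHalfPlane → ℂ) (z : UpperHalfPlane) :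
    ‖UpperHalfPlane.petersson ((n : ℤ) + 2) f f z‖ₑ =
      ENNReal.ofReal (‖f z‖ ^ 2 * z.im ^ (n + 2)) := by
  rw [← ofReal_norm, UpperHalfPlane.petersson]
  congr 1
  have h : ((n : ℤ) + 2) = ((n + 2 : ℕ) : ℤ) := by push_cast; rfl
  rw [h, zpow_natCast, norm_mul, norm_mul, norm_pow, RCLike.norm_conj, Complex.norm_real,
    Real.norm_of_nonneg z.im_pos.le, sq]

theorem proposition4 (ε : ℝ) (hε : 0 < ε) :
    ∃ C : ℝ, 0 < C ∧ ∀ n : ℕ, 0 < n → Even n → ∀ x : Quaternion ℝ, redNr x = 1 →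
      peterssonNormSq (CongruenceSubgroup.Gamma0 4) ((n : ℤ) + 2) (thetaF n x x) ≤
        ENNReal.ofReal
          (C * ((4 * Real.pi) ^ (-(n : ℝ)) * Real.Gamma ((n : ℝ) + 2) * (n : ℝ) ^ (1 + ε))) := by
  -- the bounds for a single coefficient need an exponent which is at most `1`
  set δ : ℝ := min ε 1 with hδ
  have hδ0 : 0 < δ := lt_min hε one_pos
  have : Fintype (SL(2, ℤ) ⧸ CongruenceSubgroup.Gamma0 4) := Fintype.ofFinite _
  choose φ hφ using fun q : SL(2, ℤ) ⧸ CongruenceSubgroup.Gamma0 4 =>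
    exists_thetaMod_smul q.out⁻¹ fun r => if r = 0 then 1 else 0
  choose K hK0 hK using fun q => exists_lintegral_thetaMod_le hδ0 (min_le_right ε 1) (φ q)
  have hK0' : 0 ≤ ∑ q, K q := Finset.sum_nonneg fun q _ => hK0 q
  refine ⟨∑ q, K q + 1, by linarith, fun n hn _ x hx => ?_⟩
  have hn1 : (1 : ℝ) ≤ n := by exact_mod_cast hn
  have hG : 0 < Real.Gamma ((n : ℝ) + 2) := Real.Gamma_pos_of_pos (by positivity)
  set M : ℝ := Real.pi ^ (-(n : ℝ)) * Real.Gamma (n + 2) * (n : ℝ) ^ (1 + δ) with hM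
  have hM0 : 0 ≤ M := by positivity
  have h2 : ∀ z, ‖UpperHalfPlane.petersson ((n : ℤ) + 2) (thetaF n x x) (thetaF n x x) z‖ₑ =
      ENNReal.ofReal (4 ^ (-(n : ℝ))) * ENNReal.ofReal
        (‖thetaMod n (fun r => if r = 0 then 1 else 0) z‖ ^ 2 * z.im ^ (n + 2)) := by
    intro z
    rw [enorm_petersson, thetaF_self hn hx, ← ENNReal.ofReal_mul (by positivity)]
    congr 1
    have h4 : (4 : ℝ) ^ (-(n : ℝ)) = ((2 ^ n)⁻¹) ^ 2 := by
      rw [Real.rpow_neg (by norm_num), Real.rpow_natCast, inv_pow, ← pow_mul, mul_comm n, pow_mul]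
      norm_num
    rw [norm_mul, norm_inv, norm_pow, Complex.norm_ofNat, mul_pow, h4, mul_assoc]
  rw [peterssonNormSq]
  refine (lintegral_fundDomain_le _ _).trans ?_
  calc _ ≤ ∑ q, ENNReal.ofReal (4 ^ (-(n : ℝ))) * ENNReal.ofReal (K q * M) := by
        refine Finset.sum_le_sum fun q _ => ?_
        simp_rw [h2, hφ q]
        rw [lintegral_const_mul' _ _ ENNReal.ofReal_ne_top]
        gcongr
        exact hK q n hn
    _ = ENNReal.ofReal ((∑ q, K q) * (4 ^ (-(n : ℝ)) * M)) := by
        rw [← Finset.mul_sum, ← ENNReal.ofReal_sum_of_nonneg fun q _ => mul_nonneg (hK0 q) hM0,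
          ← ENNReal.ofReal_mul (by positivity), ← Finset.sum_mul]
        congr 1; ring
    _ ≤ _ := by
        apply ENNReal.ofReal_le_ofReal
        rw [hM, Real.mul_rpow (by norm_num) Real.pi_pos.le, ← mul_assoc (4 ^ (-(n : ℝ)) : ℝ),
          ← mul_assoc (4 ^ (-(n : ℝ)) : ℝ)]
        gcongr
        · linarith
        · exact min_le_left ε 1
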